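/- Let $k$ be a commutative ring and let $\mathcal{A}=(A=\bigoplus_{i\in\mathbb{Z}}A^i,d)$ be a differential graded $k$-algebra (associative, unital) such that $A^i=0$ for $i<0$, the ring $A^0$ is semisimple, and $d(A^0)=0$. Let $\mathrm{dgHot}(\mathcal{A})$ be the homotopy category of dg right $\mathcal{A}$-modules, with its triangulated structure in which the shift $\{1\}$ is given by $(\{1\}M)^i=M^{i+1}$, $d_{\{1\}M}=-d_M$, and the distinguished triangles are those isomorphic to mapping cone triangles. Let $\mathrm{dgPer}(\mathcal{A})$ be the smallest full triangulated subcategory of $\mathrm{dgHot}(\mathcal{A})$ that contains $\mathcal{A}$ and is closed under direct summands. For a dg module $M$ put $\overline{M}=M/MA^+$, where $A^+=\bigoplus_{i>0}A^i$. Let $\heartsuit$ be the full subcategory of $\mathrm{dgPer}(\mathcal{A})$ consisting of the objects $M$ with $H^i(\overline{M})=0$ for all $i\neq 0$ (the heart of the t-structure whose aisles $\mathrm{dgPer}^{\le 0}$ and $\mathrm{dgPer}^{\ge 0}$ consist of the $M$ with $H^i(\overline{M})=0$ for $i>0$, respectively for $i<0$). Then an object $M$ of $\heartsuit$ is injective in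 $\heartsuit$ if and only if $H^1(M)=0$. -/

import Mathlib

open CategoryTheory MulOpposite

universe w u

namespace PerfectDG

/-- A structure of differential graded `k`-algebra `(A = ⨁_{i ∈ ℤ} Aⁱ, d)` on a `k`-algebra `A`. -/
structure DGAlgebra (k : Type w) [CommRing k] (A : Type u) [Ring A] [Algebra k A] where
  /-- the homogeneous components `Aⁱ` -/
  gr : ℤ → Submodule k A
  [graded : GradedAlgebra gr]
  /-- the differential -/
  d : A →ₗ[k] A
  d_mem : ∀ (i : ℤ), ∀ a ∈ gr i, d a ∈ gr (i + 1)
  d_d : ∀ a, d (d a) = 0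
  d_mul : ∀ (i : ℤ), ∀ a ∈ gr i, ∀ b, d (a * b) = d a * b + i.negOnePow • (a * d b)

attribute [instance] DGAlgebra.graded

/-- The `i`-th cohomology group `(Vⁱ ∩ ker d) / d(Vⁱ⁻¹)` of an abelian group `V` with a family
of subgroups `Vⁱ` and an additive map `d`. -/
abbrev gradedCohomology {V : Type u} [AddCommGroup V] (gr : ℤ → AddSubgroup V) (d : V →+ V)
    (i : ℤ) : Type u :=
  ↥(gr i ⊓ d.ker) ⧸ ((gr (i - 1)).map d).addSubgroupOf (gr i ⊓ d.ker)

variable {k : Type w} [CommRing k] {A : Type u} [Ring A] [Algebra k A]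

/-- A dg right module over the dg algebra `𝓐`. Right multiplication `m a` is written `op a • m`.
The `k`-module structure is the one induced by `k → A`; since the image of `k` lies in
`A⁰ ∩ ker d`, the components are automatically `k`-submodules and `d` is `k`-linear. -/
structure DGModule (𝓐 : DGAlgebra k A) where
  carrier : Type u
  [addCommGroup : AddCommGroup carrier]
  [module : Module Aᵐᵒᵖ carrier]
  /-- the homogeneous components `Mⁱ`; the next two fields say that `M = ⨁_{i ∈ ℤ} Mⁱ` -/
  gr : ℤ → AddSubgroup carrier
  gr_indep : iSupIndep gr
  gr_iSup : ⨆ i, gr i = ⊤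
  smul_mem : ∀ (i j : ℤ), ∀ m ∈ gr i, ∀ a ∈ 𝓐.gr j, op a • m ∈ gr (i + j)
  /-- the differential -/
  d : carrier →+ carrier
  d_mem : ∀ (i : ℤ), ∀ m ∈ gr i, d m ∈ gr (i + 1)
  d_d : ∀ m, d (d m) = 0
  d_smul : ∀ (i : ℤ), ∀ m ∈ gr i, ∀ a,
    d (op a • m) = op a • d m + i.negOnePow • (op (𝓐.d a) • m)

attribute [instance] DGModule.addCommGroup DGModule.module

namespace DGModule

variable {𝓐 : DGAlgebra k A}

/-- Morphisms of dg modules: `A`-linear maps of degree zero commuting with the differentials. -/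
@[ext]
structure Hom (M N : DGModule 𝓐) where
  toLin : M.carrier →ₗ[Aᵐᵒᵖ] N.carrier
  map_mem : ∀ (i : ℤ), ∀ m ∈ M.gr i, toLin m ∈ N.gr i
  map_d : ∀ m, toLin (M.d m) = N.d (toLin m)

/-- The category `dgMod(𝓐)`. -/
instance : Category (DGModule 𝓐) where
  Hom := Hom
  id M := ⟨LinearMap.id, fun _ _ h => h, fun _ => rfl⟩
  comp f g := ⟨g.toLin.comp f.toLin, fun i m h => g.map_mem i _ (f.map_mem i m h),
    fun m => by simp [f.map_d, g.map_d]⟩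

/-- `f` and `g` are homotopic: `f - g = d h + h d` for a homogeneous `A`-linear map `h`
of degree `-1`. -/
def Homotopic : HomRel (DGModule 𝓐) := fun M N f g =>
  ∃ h : M.carrier →ₗ[Aᵐᵒᵖ] N.carrier, (∀ (i : ℤ), ∀ m ∈ M.gr i, h m ∈ N.gr (i - 1)) ∧
    ∀ m, Hom.toLin f m - Hom.toLin g m = N.d (h m) + h (M.d m)

/-- Homotopy is an equivalence relation compatible with composition, so that morphisms in the
quotient category below are exactly homotopy classes. -/
instance : Congruence (Homotopic (𝓐 := 𝓐)) where
  equivalence :=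
    { refl := fun f => ⟨0, fun i m _ => by simp, fun m => by simp⟩
      symm := fun {f g} ⟨h, h1, h2⟩ => ⟨-h, fun i m hm => by simpa using h1 i m hm, fun m => by
        have := h2 m
        simp only [LinearMap.neg_apply, map_neg]
        rw [← neg_sub, this]; abel⟩
      trans := fun {f g e} ⟨h, h1, h2⟩ ⟨h', h1', h2'⟩ =>
        ⟨h + h', fun i m hm => by simpa using add_mem (h1 i m hm) (h1' i m hm), fun m => by
          simp only [LinearMap.add_apply, map_add]
          rw [← sub_add_sub_cancel _ (Hom.toLin g m), h2, h2']; abel⟩ }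
  comp_left := fun {X Y Z} f {g g'} ⟨h, h1, h2⟩ =>
    ⟨h.comp (Hom.toLin f), fun i m hm => h1 i _ (Hom.map_mem f i m hm), fun m => by
      have := h2 (Hom.toLin f m)
      rw [← Hom.map_d f] at this
      exact this⟩
  comp_right := fun {X Y Z f f'} g ⟨h, h1, h2⟩ =>
    ⟨(Hom.toLin g).comp h, fun i m hm => Hom.map_mem g _ _ (h1 i m hm), fun m => by
      have := congrArg (Hom.toLin g) (h2 m)
      rw [map_sub, map_add, Hom.map_d g] at this
      exact this⟩

/-- `𝓐` as a dg right module over itself. -/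
def regular (𝓐 : DGAlgebra k A) : DGModule 𝓐 where
  carrier := A
  gr i := (𝓐.gr i).toAddSubgroup
  gr_indep := by
    have h := (DirectSum.Decomposition.isInternal 𝓐.gr).submodule_iSupIndep
    intro i
    rw [disjoint_iff_inf_le]
    intro x ⟨hx1, hx2⟩
    have key : (⨆ (j) (_ : j ≠ i), (𝓐.gr j).toAddSubgroup) ≤
        (⨆ (j) (_ : j ≠ i), 𝓐.gr j).toAddSubgroup :=
      iSup₂_le fun j hj => (le_iSup₂ (f := fun j (_ : j ≠ i) => 𝓐.gr j) j hj :)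
    exact Submodule.disjoint_def.mp (h i) x hx1 (key hx2)
  gr_iSup := by
    rw [eq_top_iff]
    intro x _
    classical
    rw [← DirectSum.sum_support_decompose 𝓐.gr x]
    exact sum_mem fun i _ =>
      (le_iSup (fun i => (𝓐.gr i).toAddSubgroup) i) (DirectSum.decompose 𝓐.gr x i).2
  smul_mem i j m hm a ha := SetLike.mul_mem_graded (A := 𝓐.gr) hm ha
  d := 𝓐.d.toAddMonoidHom
  d_mem := 𝓐.d_mem
  d_d := 𝓐.d_d
  d_smul := 𝓐.d_mul

/-- The shift `{n}M`: `({n}M)ⁱ = Mⁱ⁺ⁿ`, with differential `(-1)ⁿ d` and the same action of `A`. -/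
def shift (M : DGModule 𝓐) (n : ℤ) : DGModule 𝓐 where
  carrier := M.carrier
  gr i := M.gr (i + n)
  gr_indep := M.gr_indep.comp (add_left_injective n)
  gr_iSup := by
    rw [← M.gr_iSup]
    exact (Equiv.addRight n).iSup_comp (g := M.gr)
  smul_mem i j m hm a ha := by
    have := M.smul_mem _ j m hm a ha
    rwa [show i + j + n = i + n + j by ring]
  d := n.negOnePow • M.d
  d_mem i m hm := by
    have := M.d_mem _ m hm
    rw [show i + 1 + n = i + n + 1 by ring]
    rcases Int.units_eq_one_or n.negOnePow with h | h <;> rw [h] <;> simpa using this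
  d_d m := by
    rcases Int.units_eq_one_or n.negOnePow with h | h <;> rw [h] <;> simp [M.d_d]
  d_smul i m hm a := by
    have := M.d_smul _ m hm a
    rw [Int.negOnePow_add] at this
    rcases Int.units_eq_one_or n.negOnePow with h | h <;> rw [h] at this ⊢ <;>
      simp [this, add_comm]

/-- The mapping cone `N ⊕ {1}M` of a morphism `f : M ⟶ N`, with differential
`(n, m) ↦ (d n + f m, - d m)`. -/
def cone {M N : DGModule 𝓐} (f : M ⟶ N) : DGModule 𝓐 where
  carrier := N.carrier × M.carrier
  gr i := (N.gr i).prod (M.gr (i + 1))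
  gr_indep := by
    intro i
    rw [disjoint_iff_inf_le]
    intro x ⟨hx1, hx2⟩
    have h1 : x.1 ∈ ⨆ (j) (_ : j ≠ i), N.gr j := by
      have key : (⨆ (j) (_ : j ≠ i), (N.gr j).prod (M.gr (j + 1))) ≤
          (⨆ (j) (_ : j ≠ i), N.gr j).comap (AddMonoidHom.fst _ _) :=
        iSup₂_le fun j hj y hy => (le_iSup₂ (f := fun j (_ : j ≠ i) => N.gr j) j hj :) hy.1
      exact key hx2
    have h2 : x.2 ∈ ⨆ (j) (_ : j ≠ i + 1), M.gr j := by
      have key : (⨆ (j) (_ : j ≠ i), (N.gr j).prod (M.gr (j + 1))) ≤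
          (⨆ (j) (_ : j ≠ i + 1), M.gr j).comap (AddMonoidHom.snd _ _) :=
        iSup₂_le fun j hj y hy =>
          (le_iSup₂ (f := fun j (_ : j ≠ i + 1) => M.gr j) (j + 1) (by omega) :) hy.2
      exact key hx2
    exact Prod.ext (AddSubgroup.disjoint_def.mp (N.gr_indep i) hx1.1 h1)
      (AddSubgroup.disjoint_def.mp (M.gr_indep (i + 1)) hx1.2 h2)
  gr_iSup := by
    rw [eq_top_iff]
    intro x _
    have h1 : (⊤ : AddSubgroup N.carrier) ≤
        (⨆ i, (N.gr i).prod (M.gr (i + 1))).comap (AddMonoidHom.inl _ _) := by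
      rw [← N.gr_iSup]
      exact iSup_le fun i y hy =>
        (le_iSup (fun i => (N.gr i).prod (M.gr (i + 1))) i) ⟨hy, zero_mem _⟩
    have h2 : (⊤ : AddSubgroup M.carrier) ≤
        (⨆ i, (N.gr i).prod (M.gr (i + 1))).comap (AddMonoidHom.inr _ _) := by
      rw [← M.gr_iSup]
      exact iSup_le fun i y hy =>
        (le_iSup (fun i => (N.gr i).prod (M.gr (i + 1))) (i - 1))
          ⟨zero_mem _, by simpa using hy⟩
    rw [show x = AddMonoidHom.inl _ _ x.1 + AddMonoidHom.inr _ _ x.2 by simp]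
    exact add_mem (h1 (AddSubgroup.mem_top x.1)) (h2 (AddSubgroup.mem_top x.2))
  smul_mem i j m hm a ha := ⟨N.smul_mem _ _ _ hm.1 _ ha, by
    have := M.smul_mem _ _ _ hm.2 _ ha
    rwa [show i + 1 + j = i + j + 1 by ring] at this⟩
  d := (N.d.comp (AddMonoidHom.fst _ _) +
      (Hom.toLin f).toAddMonoidHom.comp (AddMonoidHom.snd _ _)).prod
    (-(M.d.comp (AddMonoidHom.snd _ _)))
  d_mem i m hm := ⟨by simpa using add_mem (N.d_mem _ _ hm.1) (Hom.map_mem f _ _ hm.2),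
    by simpa using M.d_mem _ _ hm.2⟩
  d_d m := by
    ext <;> simp [N.d_d, M.d_d, Hom.map_d f]
  d_smul i m hm a := by
    have h1 := N.d_smul _ _ hm.1 a
    have h2 := M.d_smul _ _ hm.2 a
    rw [Int.negOnePow_succ] at h2
    refine Prod.ext ?_ ?_
    · simp [h1]; abel
    · simp [h2]; abel

/-- The cohomology `Hⁱ(M)`. -/
abbrev cohomology (M : DGModule 𝓐) (i : ℤ) : Type u := gradedCohomology M.gr M.d i

/-- `M A⁺`, where `A⁺ = ⨁_{j > 0} Aʲ`: the subgroup generated by all products `m a` of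
homogeneous elements with `a` of positive degree. -/
def mulAugmentation (M : DGModule 𝓐) : AddSubgroup M.carrier :=
  AddSubgroup.closure {x | ∃ (i j : ℤ) (m : M.carrier) (a : A),
    m ∈ M.gr i ∧ 0 < j ∧ a ∈ 𝓐.gr j ∧ x = op a • m}

lemma d_mem_mulAugmentation (M : DGModule 𝓐) :
    M.mulAugmentation ≤ M.mulAugmentation.comap M.d := by
  refine (AddSubgroup.closure_le _).mpr ?_
  rintro _ ⟨i, j, m, a, hm, hj, ha, rfl⟩
  have h1 : op a • M.d m ∈ M.mulAugmentation :=
    AddSubgroup.subset_closure ⟨_, j, _, a, M.d_mem i m hm, hj, ha, rfl⟩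
  have h2 : op (𝓐.d a) • m ∈ M.mulAugmentation :=
    AddSubgroup.subset_closure ⟨i, j + 1, m, _, hm, by omega, 𝓐.d_mem j a ha, rfl⟩
  change M.d (op a • m) ∈ M.mulAugmentation
  rw [M.d_smul i m hm a]
  rcases Int.units_eq_one_or i.negOnePow with h | h <;> rw [h]
  · simpa using add_mem h1 h2
  · simpa using add_mem h1 (neg_mem h2)

/-- The underlying abelian group of `M̄ = M / M A⁺ = M ⊗_𝓐 𝓐⁰`. -/
abbrev Bar (M : DGModule 𝓐) : Type u := M.carrier ⧸ M.mulAugmentation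

/-- The homogeneous components of `M̄`. -/
def barGr (M : DGModule 𝓐) (i : ℤ) : AddSubgroup M.Bar :=
  (M.gr i).map (QuotientAddGroup.mk' M.mulAugmentation)

/-- The differential of `M̄`. -/
def barD (M : DGModule 𝓐) : M.Bar →+ M.Bar :=
  QuotientAddGroup.map _ _ M.d M.d_mem_mulAugmentation

/-- The support of `H(M̄)`: the set of all `i` with `Hⁱ(M̄) ≠ 0`. -/
def barSupport (M : DGModule 𝓐) : Set ℤ :=
  {i | Nontrivial (gradedCohomology M.barGr M.barD i)}

end DGModule

/-- The homotopy category `dgHot(𝓐)` of dg modules. -/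
abbrev DGHot (𝓐 : DGAlgebra k A) := Quotient (DGModule.Homotopic (𝓐 := 𝓐))

/-- The image in `dgHot(𝓐)` of a dg module. -/
abbrev toHot {𝓐 : DGAlgebra k A} (M : DGModule 𝓐) : DGHot 𝓐 :=
  (Quotient.functor (DGModule.Homotopic (𝓐 := 𝓐))).obj M

/-- The objects of `dgPer(𝓐)`: the smallest full subcategory of `dgHot(𝓐)` which contains `𝓐`,
is triangulated (stable under shifts and mapping cones, the distinguished triangles being those
isomorphic to a mapping cone triangle) and stable under direct summands. In a triangulated
category direct summands are the same as retracts; stability under retracts includes stability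
under isomorphisms. -/
inductive IsPerfect (𝓐 : DGAlgebra k A) : ObjectProperty (DGHot 𝓐)
  | regular : IsPerfect 𝓐 (toHot (DGModule.regular 𝓐))
  | shift (M : DGModule 𝓐) (n : ℤ) : IsPerfect 𝓐 (toHot M) → IsPerfect 𝓐 (toHot (M.shift n))
  | cone {M N : DGModule 𝓐} (f : M ⟶ N) : IsPerfect 𝓐 (toHot M) → IsPerfect 𝓐 (toHot N) →
      IsPerfect 𝓐 (toHot (DGModule.cone f))
  | retract {X Y : DGHot 𝓐} (r : Retract X Y) : IsPerfect 𝓐 Y → IsPerfect 𝓐 X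

/-- `dgPer^I`: the perfect dg modules `M` such that `H(M̄)` is supported in `I ⊆ ℤ`. -/
def perfectSupportedIn (𝓐 : DGAlgebra k A) (I : Set ℤ) : ObjectProperty (DGHot 𝓐) :=
  fun X => IsPerfect 𝓐 X ∧ X.as.barSupport ⊆ I

/-- The heart `♥ = dgPer⁰ = dgPer^{≤ 0} ∩ dgPer^{≥ 0}`, a full subcategory of `dgHot(𝓐)`. -/
abbrev Heart (𝓐 : DGAlgebra k A) := (perfectSupportedIn 𝓐 {0}).FullSubcategory

end PerfectDG

/-!
Every perfect dg module is a homotopy retract of a dg module with a finite cell basis. Gaussian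
elimination along the invertible entries of the differential makes the basis minimal; the
differential is then zero modulo `A⁺`, and the cells of an object of the heart may be taken in
degree zero.

A class in `H¹(M)` is a morphism `{-1}𝓐 ⟶ M`. Its cone lies in the heart and contains `M` as a
subobject, and this subobject splits off precisely when the class vanishes. Conversely, let
`f : X ⟶ Y` be a monomorphism of the heart; then `H⁰(f)` is injective. A morphism `g : X ⟶ M`
extends along `f` when its composition with the connecting morphism `cone f ⟶ {1}X` is zero. A
minimal model of `cone f` has its cells in degrees `-1` and `0`: the obstructions on the former
vanish because `H⁰(f)` is injective, those on the latter because `H¹(M) = 0`.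
-/

namespace PerfectDG

variable {k : Type w} [CommRing k] {A : Type u} [Ring A] [Algebra k A] {𝓐 : DGAlgebra k A}

/-! ### Homotopies, shifts and cones -/

namespace DGModule

lemma homogeneous_induction (M : DGModule 𝓐) {P : M.carrier → Prop} (zero : P 0)
    (add : ∀ x y, P x → P y → P (x + y)) (mem : ∀ i, ∀ x ∈ M.gr i, P x) (x : M.carrier) : P x := by
  have hx : x ∈ ⨆ i, M.gr i := M.gr_iSup ▸ AddSubgroup.mem_top x
  exact AddSubgroup.iSup_induction M.gr (C := P) hx mem zero add

section Preadditive

variable {M N P : DGModule 𝓐}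

lemma hom_ext {f g : M ⟶ N} (h : ∀ m, Hom.toLin f m = Hom.toLin g m) : f = g :=
  Hom.ext (LinearMap.ext h)

@[simp] lemma comp_toLin (f : M ⟶ N) (g : N ⟶ P) (m : M.carrier) :
    Hom.toLin (f ≫ g) m = Hom.toLin g (Hom.toLin f m) := rfl

@[simp] lemma id_toLin (m : M.carrier) : Hom.toLin (𝟙 M) m = m := rfl

instance : Zero (M ⟶ N) where
  zero := ⟨0, fun _ _ _ => zero_mem _, fun m => by simp⟩

instance : Add (M ⟶ N) where
  add f g := ⟨Hom.toLin f + Hom.toLin g,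
    fun i m hm => add_mem (Hom.map_mem f i m hm) (Hom.map_mem g i m hm),
    fun m => by simp [Hom.map_d]⟩

instance : Neg (M ⟶ N) where
  neg f := ⟨-Hom.toLin f, fun i m hm => neg_mem (Hom.map_mem f i m hm), fun m => by
    simp [Hom.map_d]⟩

@[simp] lemma zero_toLin (m : M.carrier) : Hom.toLin (0 : M ⟶ N) m = 0 := rfl

@[simp] lemma add_toLin (f g : M ⟶ N) (m : M.carrier) :
    Hom.toLin (f + g) m = Hom.toLin f m + Hom.toLin g m := rfl

@[simp] lemma neg_toLin (f : M ⟶ N) (m : M.carrier) :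
    Hom.toLin (-f) m = -Hom.toLin f m := rfl

instance : AddCommGroup (M ⟶ N) where
  __ := AddGroup.ofLeftAxioms (G := M ⟶ N) (fun _ _ _ => hom_ext fun _ => add_assoc _ _ _)
    (fun _ => hom_ext fun _ => zero_add _) (fun _ => hom_ext fun _ => neg_add_cancel _)
  add_comm _ _ := hom_ext fun _ => add_comm _ _

@[simp] lemma sub_toLin (f g : M ⟶ N) (m : M.carrier) :
    Hom.toLin (f - g) m = Hom.toLin f m - Hom.toLin g m := by
  rw [sub_eq_add_neg, sub_eq_add_neg, add_toLin, neg_toLin]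

instance : Preadditive (DGModule 𝓐) where
  add_comp _ _ _ f f' g := hom_ext fun _ => map_add (Hom.toLin g) _ _
  comp_add _ _ _ _ _ _ := rfl

end Preadditive

section Homotopy

variable {M N P : DGModule 𝓐}

/-- The null-homotopic morphism `d h + h d` defined by a linear map `h` of degree `-1`. -/
def nullHom (h : M.carrier →ₗ[Aᵐᵒᵖ] N.carrier)
    (hh : ∀ i, ∀ m ∈ M.gr i, h m ∈ N.gr (i - 1)) : M ⟶ N where
  toLin :=
    { toFun := fun m => N.d (h m) + h (M.d m)
      map_add' := fun x y => by simp only [map_add]; abel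
      map_smul' := fun r x => by
        obtain ⟨a, rfl⟩ := op_surjective r
        refine M.homogeneous_induction (P := fun x => N.d (h (op a • x)) + h (M.d (op a • x)) =
          op a • (N.d (h x) + h (M.d x))) (by simp) (fun x y hx hy => ?_) (fun i x hx => ?_) x
        · simp only [smul_add, map_add] at hx hy ⊢
          rw [add_add_add_comm, hx, hy]
          abel
        · rw [map_smul, M.d_smul i x hx, N.d_smul _ _ (hh i x hx), Int.negOnePow_sub,
            Int.negOnePow_one, mul_neg, mul_one, Units.neg_smul, map_add, map_smul, smul_add]
          simp only [Units.smul_def, map_zsmul, map_smul]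
          abel }
  map_mem i m hm := by
    have h1 := N.d_mem _ _ (hh i m hm)
    have h2 := hh _ _ (M.d_mem i m hm)
    rw [sub_add_cancel] at h1
    rw [add_sub_cancel_right] at h2
    exact add_mem h1 h2
  map_d m := by simp [N.d_d, M.d_d]

@[simp] lemma nullHom_toLin (h : M.carrier →ₗ[Aᵐᵒᵖ] N.carrier)
    (hh : ∀ i, ∀ m ∈ M.gr i, h m ∈ N.gr (i - 1)) (m : M.carrier) :
    Hom.toLin (nullHom h hh) m = N.d (h m) + h (M.d m) := rfl

lemma Homotopic.refl (f : M ⟶ N) : Homotopic f f :=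
  Congruence.equivalence.refl f

lemma Homotopic.symm {f g : M ⟶ N} (h : Homotopic f g) : Homotopic g f :=
  Congruence.equivalence.symm h

lemma Homotopic.trans {f g e : M ⟶ N} (h : Homotopic f g) (h' : Homotopic g e) : Homotopic f e :=
  Congruence.equivalence.trans h h'

lemma Homotopic.comp_left (f : M ⟶ N) {g g' : N ⟶ P} (h : Homotopic g g') :
    Homotopic (f ≫ g) (f ≫ g') :=
  HomRel.comp_left f h

lemma Homotopic.comp_right {f f' : M ⟶ N} (g : N ⟶ P) (h : Homotopic f f') :
    Homotopic (f ≫ g) (f' ≫ g) :=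
  HomRel.comp_right g h

lemma Homotopic.comp_zero {f : M ⟶ N} (hf : Homotopic f 0) (g : N ⟶ P) : Homotopic (f ≫ g) 0 := by
  simpa only [Limits.zero_comp] using hf.comp_right g

lemma Homotopic.zero_comp (f : M ⟶ N) {g : N ⟶ P} (hg : Homotopic g 0) : Homotopic (f ≫ g) 0 := by
  simpa only [Limits.comp_zero] using hg.comp_left f

lemma Homotopic.zero_of_retract {X Y Z : DGModule 𝓐} {i : X ⟶ Y} {r : Y ⟶ X}
    (h : Homotopic (i ≫ r) (𝟙 X)) {f : X ⟶ Z} (hf : Homotopic (r ≫ f) 0) : Homotopic f 0 := by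
  have h_comp := h.symm.comp_right f
  rw [Category.id_comp, Category.assoc] at h_comp
  exact h_comp.trans (hf.zero_comp i)

lemma homotopic_sub_nullHom (f : M ⟶ N) (h : M.carrier →ₗ[Aᵐᵒᵖ] N.carrier)
    (hh : ∀ i, ∀ m ∈ M.gr i, h m ∈ N.gr (i - 1)) : Homotopic f (f - nullHom h hh) :=
  ⟨h, hh, fun m => by rw [sub_toLin, sub_sub_cancel, nullHom_toLin]⟩

lemma homotopic_iff_sub_homotopic_zero {f g : M ⟶ N} : Homotopic f g ↔ Homotopic (f - g) 0 := by
  simp only [Homotopic, sub_toLin, zero_toLin, sub_zero]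

lemma exists_d_eq_of_map_eq_zero {X Y : DGModule 𝓐} {i : X ⟶ Y} {r : Y ⟶ X}
    (h : Homotopic (i ≫ r) (𝟙 X)) {n : ℤ} {z : X.carrier} (hz : z ∈ X.gr n) (hdz : X.d z = 0)
    (hiz : Hom.toLin i z = 0) : ∃ y ∈ X.gr (n - 1), X.d y = z := by
  obtain ⟨s, s_mem, s_eq⟩ := h.symm
  refine ⟨s z, s_mem n z hz, ?_⟩
  have := s_eq z
  rw [id_toLin, comp_toLin, hiz, hdz, map_zero, map_zero, sub_zero, add_zero] at this
  exact this.symm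

/-- `X` is a retract of `Y` up to homotopy. -/
def IsHomotopyRetract (X Y : DGModule 𝓐) : Prop :=
  ∃ (i : X ⟶ Y) (r : Y ⟶ X), Homotopic (i ≫ r) (𝟙 X)

lemma IsHomotopyRetract.refl (X : DGModule 𝓐) : IsHomotopyRetract X X :=
  ⟨𝟙 X, 𝟙 X, Category.comp_id (𝟙 X) ▸ Homotopic.refl _⟩

lemma IsHomotopyRetract.trans {X Y Z : DGModule 𝓐} (hXY : IsHomotopyRetract X Y)
    (hYZ : IsHomotopyRetract Y Z) : IsHomotopyRetract X Z := by
  obtain ⟨i, r, h⟩ := hXY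
  obtain ⟨i', r', h'⟩ := hYZ
  refine ⟨i ≫ i', r' ≫ r, ?_⟩
  have := (h'.comp_right r).comp_left i
  rw [Category.id_comp] at this
  simpa only [Category.assoc] using this.trans h

lemma isHomotopyRetract_of_retract {X Y : DGModule 𝓐} (ρ : Retract (toHot X) (toHot Y)) :
    IsHomotopyRetract X Y := by
  obtain ⟨i, hi⟩ := (Quotient.functor (Homotopic (𝓐 := 𝓐))).map_surjective ρ.i
  obtain ⟨r, hr⟩ := (Quotient.functor (Homotopic (𝓐 := 𝓐))).map_surjective ρ.r
  refine ⟨i, r, ?_⟩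
  rw [← Quotient.functor_map_eq_iff Homotopic, Functor.map_comp, hi, hr, ρ.retract]
  exact (CategoryTheory.Functor.map_id _ X).symm

end Homotopy

section Shift

/-- The identity of the underlying modules, as a map `M → {n}M`. -/
def toShift (M : DGModule 𝓐) (n : ℤ) : M.carrier →ₗ[Aᵐᵒᵖ] (M.shift n).carrier :=
  { toFun := fun m => m, map_add' := fun _ _ => rfl, map_smul' := fun _ _ => rfl }

/-- The identity of the underlying modules, as a map `{n}M → M`. -/
def ofShift (M : DGModule 𝓐) (n : ℤ) : (M.shift n).carrier →ₗ[Aᵐᵒᵖ] M.carrier :=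
  { toFun := fun m => m, map_add' := fun _ _ => rfl, map_smul' := fun _ _ => rfl }

@[simp] lemma ofShift_toShift (M : DGModule 𝓐) (n : ℤ) (m : M.carrier) :
    M.ofShift n (M.toShift n m) = m := rfl

@[simp] lemma toShift_ofShift (M : DGModule 𝓐) (n : ℤ) (m : (M.shift n).carrier) :
    M.toShift n (M.ofShift n m) = m := rfl

lemma ofShift_d (M : DGModule 𝓐) (n : ℤ) (m : (M.shift n).carrier) :
    M.ofShift n ((M.shift n).d m) = n.negOnePow • M.d (M.ofShift n m) := rfl

lemma d_toShift (M : DGModule 𝓐) (n : ℤ) (m : M.carrier) :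
    (M.shift n).d (M.toShift n m) = n.negOnePow • M.toShift n (M.d m) := rfl

lemma d_ofShift (M : DGModule 𝓐) (n : ℤ) (m : (M.shift n).carrier) :
    M.d (M.ofShift n m) = n.negOnePow • M.ofShift n ((M.shift n).d m) := by
  rw [ofShift_d, smul_smul, Int.units_mul_self, one_smul]

@[simp] lemma toShift_mem (M : DGModule 𝓐) {n i : ℤ} {m : M.carrier} :
    M.toShift n m ∈ (M.shift n).gr i ↔ m ∈ M.gr (i + n) := Iff.rfl

@[simp] lemma ofShift_mem (M : DGModule 𝓐) {n i : ℤ} {m : (M.shift n).carrier} :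
    M.ofShift n m ∈ M.gr (i + n) ↔ m ∈ (M.shift n).gr i := Iff.rfl

/-- The shift of a morphism. -/
def shiftMap {M N : DGModule 𝓐} (f : M ⟶ N) (n : ℤ) : M.shift n ⟶ N.shift n where
  toLin := N.toShift n ∘ₗ Hom.toLin f ∘ₗ M.ofShift n
  map_mem i m hm := Hom.map_mem f (i + n) _ hm
  map_d m := by
    rcases Int.units_eq_one_or n.negOnePow with h | h <;> simp [ofShift_d, d_toShift, Hom.map_d, h]

@[simp] lemma shiftMap_toLin {M N : DGModule 𝓐} (f : M ⟶ N) (n : ℤ) (m : (M.shift n).carrier) :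
    Hom.toLin (shiftMap f n) m = N.toShift n (Hom.toLin f (M.ofShift n m)) := rfl

lemma Homotopic.shiftMap {M N : DGModule 𝓐} {f g : M ⟶ N} (h : Homotopic f g) (n : ℤ) :
    Homotopic (DGModule.shiftMap f n) (DGModule.shiftMap g n) := by
  obtain ⟨h, h_mem, h_eq⟩ := h
  refine ⟨((n.negOnePow : ℤˣ) : ℤ) • (N.toShift n ∘ₗ h ∘ₗ M.ofShift n), fun i m hm =>
    zsmul_mem ?_ _, fun m => ?_⟩
  · rw [LinearMap.comp_apply, toShift_mem, sub_add_eq_add_sub]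
    exact h_mem _ _ hm
  · rcases Int.units_eq_one_or n.negOnePow with hn | hn <;>
      simp [d_toShift, ofShift_d, hn, ← map_sub, ← map_add, h_eq]

lemma IsHomotopyRetract.shift {X Y : DGModule 𝓐} (h : IsHomotopyRetract X Y) (n : ℤ) :
    IsHomotopyRetract (X.shift n) (Y.shift n) :=
  have ⟨i, r, hir⟩ := h
  ⟨shiftMap i n, shiftMap r n, hir.shiftMap n⟩

lemma exists_shift_d_eq {M : DGModule 𝓐} {n i : ℤ} {w : (M.shift n).carrier}
    (h : ∃ y ∈ M.gr (i + n - 1), M.d y = M.ofShift n w) :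
    ∃ y ∈ (M.shift n).gr (i - 1), (M.shift n).d y = w := by
  obtain ⟨y, hy, hdy⟩ := h
  refine ⟨n.negOnePow • M.toShift n y, ?_, ?_⟩
  · rw [Units.smul_def]
    refine zsmul_mem ?_ _
    rwa [toShift_mem, sub_add_eq_add_sub]
  · rw [Units.smul_def, map_zsmul, d_toShift, hdy, toShift_ofShift, ← Units.smul_def, smul_smul,
      Int.units_mul_self, one_smul]

end Shift

section Cone

variable {M N : DGModule 𝓐} (f : M ⟶ N)

/-- The inclusion of the target in the cone. -/
def coneInl : N.carrier →ₗ[Aᵐᵒᵖ] (cone f).carrier := LinearMap.inl Aᵐᵒᵖ N.carrier M.carrier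

/-- The inclusion of the source in the cone. -/
def coneInr : M.carrier →ₗ[Aᵐᵒᵖ] (cone f).carrier := LinearMap.inr Aᵐᵒᵖ N.carrier M.carrier

/-- The projection of the cone to the target. -/
def coneFst : (cone f).carrier →ₗ[Aᵐᵒᵖ] N.carrier := LinearMap.fst Aᵐᵒᵖ N.carrier M.carrier

/-- The projection of the cone to the source. -/
def coneSnd : (cone f).carrier →ₗ[Aᵐᵒᵖ] M.carrier := LinearMap.snd Aᵐᵒᵖ N.carrier M.carrier

@[simp] lemma coneFst_coneInl (n : N.carrier) : coneFst f (coneInl f n) = n := rfl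
@[simp] lemma coneSnd_coneInl (n : N.carrier) : coneSnd f (coneInl f n) = 0 := rfl
@[simp] lemma coneFst_coneInr (m : M.carrier) : coneFst f (coneInr f m) = 0 := rfl
@[simp] lemma coneSnd_coneInr (m : M.carrier) : coneSnd f (coneInr f m) = m := rfl

variable {f} in
lemma cone_ext {x y : (cone f).carrier} (h1 : coneFst f x = coneFst f y)
    (h2 : coneSnd f x = coneSnd f y) : x = y :=
  Prod.ext h1 h2

@[simp] lemma coneFst_d (x : (cone f).carrier) :
    coneFst f ((cone f).d x) = N.d (coneFst f x) + Hom.toLin f (coneSnd f x) := rfl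

@[simp] lemma coneSnd_d (x : (cone f).carrier) :
    coneSnd f ((cone f).d x) = - M.d (coneSnd f x) := rfl

@[simp] lemma d_coneInl (n : N.carrier) : (cone f).d (coneInl f n) = coneInl f (N.d n) :=
  cone_ext (by simp) (by simp)

@[simp] lemma d_coneInr (m : M.carrier) :
    (cone f).d (coneInr f m) = coneInl f (Hom.toLin f m) - coneInr f (M.d m) :=
  cone_ext (by simp) (by simp)

lemma mem_cone_gr {i : ℤ} {x : (cone f).carrier} :
    x ∈ (cone f).gr i ↔ coneFst f x ∈ N.gr i ∧ coneSnd f x ∈ M.gr (i + 1) := Iff.rfl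

lemma coneInl_mem {i : ℤ} {n : N.carrier} (h : n ∈ N.gr i) : coneInl f n ∈ (cone f).gr i :=
  ⟨h, zero_mem _⟩

lemma coneInr_mem {i : ℤ} {m : M.carrier} (h : m ∈ M.gr i) : coneInr f m ∈ (cone f).gr (i - 1) :=
  ⟨zero_mem _, by rwa [sub_add_cancel]⟩

/-- The inclusion `N ⟶ cone f`. -/
def coneInlHom : N ⟶ cone f where
  toLin := coneInl f
  map_mem _ _ hm := coneInl_mem f hm
  map_d m := by simp

@[simp] lemma coneInlHom_toLin (n : N.carrier) :
    Hom.toLin (coneInlHom f) n = coneInl f n := rfl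

/-- The projection `cone f ⟶ {1}M`. -/
def coneSndHom : cone f ⟶ M.shift 1 where
  toLin := M.toShift 1 ∘ₗ coneSnd f
  map_mem i m hm := hm.2
  map_d m := by simp [d_toShift]

@[simp] lemma coneSndHom_toLin (x : (cone f).carrier) :
    Hom.toLin (coneSndHom f) x = M.toShift 1 (coneSnd f x) := rfl

/-- The morphism of cones `(n, m) ↦ (b n + s m, a m)` induced by a square that commutes up to the
homotopy `s`. -/
def coneMap {f : M ⟶ N} {M' N' : DGModule 𝓐} {f' : M' ⟶ N'} (a : M ⟶ M') (b : N ⟶ N')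
    (s : M.carrier →ₗ[Aᵐᵒᵖ] N'.carrier) (s_mem : ∀ i, ∀ m ∈ M.gr i, s m ∈ N'.gr (i - 1))
    (s_eq : ∀ m, Hom.toLin (f ≫ b) m - Hom.toLin (a ≫ f') m = N'.d (s m) + s (M.d m)) :
    cone f ⟶ cone f' where
  toLin := coneInl f' ∘ₗ (Hom.toLin b ∘ₗ coneFst f + s ∘ₗ coneSnd f) +
    coneInr f' ∘ₗ Hom.toLin a ∘ₗ coneSnd f
  map_mem i x hx := by
    obtain ⟨h_fst, h_snd⟩ := (mem_cone_gr f).1 hx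
    have h_s := s_mem _ _ h_snd
    have h_a := coneInr_mem f' (Hom.map_mem a _ _ h_snd)
    rw [add_sub_cancel_right] at h_s h_a
    exact add_mem (coneInl_mem f' (add_mem (Hom.map_mem b i _ h_fst) h_s)) h_a
  map_d x := by
    refine cone_ext ?_ (by simp [Hom.map_d])
    have := s_eq (coneSnd f x)
    simp only [comp_toLin] at this
    simp only [LinearMap.add_apply, LinearMap.comp_apply, map_add, coneFst_coneInl,
      coneFst_coneInr, coneSnd_coneInl, coneSnd_coneInr, coneFst_d, coneSnd_d, map_neg, map_zero,
      Hom.map_d, sub_eq_iff_eq_add.1 this]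
    abel

@[simp] lemma coneFst_coneMap {f : M ⟶ N} {M' N' : DGModule 𝓐} {f' : M' ⟶ N'} (a : M ⟶ M')
    (b : N ⟶ N') (s : M.carrier →ₗ[Aᵐᵒᵖ] N'.carrier) (s_mem s_eq) (x : (cone f).carrier) :
    coneFst f' (Hom.toLin (coneMap a b s s_mem s_eq) x) =
      Hom.toLin b (coneFst f x) + s (coneSnd f x) := by
  simp [coneMap]

@[simp] lemma coneSnd_coneMap {f : M ⟶ N} {M' N' : DGModule 𝓐} {f' : M' ⟶ N'} (a : M ⟶ M')
    (b : N ⟶ N') (s : M.carrier →ₗ[Aᵐᵒᵖ] N'.carrier) (s_mem s_eq) (x : (cone f).carrier) :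
    coneSnd f' (Hom.toLin (coneMap a b s s_mem s_eq) x) = Hom.toLin a (coneSnd f x) := by
  simp [coneMap]

lemma isHomotopyRetract_cone {X X' P P' : DGModule 𝓐} (f : X ⟶ X') {i : X ⟶ P} {r : P ⟶ X}
    {i' : X' ⟶ P'} {r' : P' ⟶ X'} (h : Homotopic (i ≫ r) (𝟙 X))
    (h' : Homotopic (i' ≫ r') (𝟙 X')) :
    IsHomotopyRetract (cone f) (cone (r ≫ f ≫ i')) := by
  obtain ⟨s, s_mem, s_eq⟩ := h.symm
  obtain ⟨t, t_mem, t_eq⟩ := h'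
  simp only [comp_toLin, id_toLin] at s_eq t_eq
  let F := Hom.toLin f
  let ι : cone f ⟶ cone (r ≫ f ≫ i') := coneMap i i' (Hom.toLin i' ∘ₗ F ∘ₗ s)
    (fun j m hm => Hom.map_mem i' _ _ (Hom.map_mem f _ _ (s_mem j m hm)))
    (fun m => by simp [F, ← map_sub, ← map_add, ← Hom.map_d, s_eq])
  let ρ : cone (r ≫ f ≫ i') ⟶ cone f := coneMap r r' (t ∘ₗ F ∘ₗ Hom.toLin r)
    (fun j m hm => t_mem _ _ (Hom.map_mem f _ _ (Hom.map_mem r _ _ hm)))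
    (fun m => by simp [F, Hom.map_d, t_eq])
  have ts_mem (j : ℤ) (m : X.carrier) (hm : m ∈ X.gr (j + 1)) : t (F (s m)) ∈ X'.gr (j - 1) := by
    have := t_mem _ _ (Hom.map_mem f _ _ (s_mem _ _ hm))
    rwa [add_sub_cancel_right] at this
  refine ⟨ι, ρ, coneInl f ∘ₗ (t ∘ₗ coneFst f + t ∘ₗ F ∘ₗ s ∘ₗ coneSnd f) +
    coneInr f ∘ₗ s ∘ₗ coneSnd f, fun j x hx => ?_, fun x => cone_ext ?_ ?_⟩
  · obtain ⟨h_fst, h_snd⟩ := (mem_cone_gr f).1 hx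
    have := coneInr_mem f (s_mem _ _ h_snd)
    rw [add_sub_cancel_right] at this
    exact add_mem (coneInl_mem _ (add_mem (t_mem _ _ h_fst) (ts_mem j _ h_snd))) this
  · have h₁ := t_eq (coneFst f x)
    have h₂ := t_eq (F (s (coneSnd f x)))
    have h₃ := congrArg (fun y => t (F y)) (s_eq (coneSnd f x))
    simp only [F, map_sub, map_add, Hom.map_d] at h₁ h₂ h₃
    rw [sub_eq_iff_eq_add] at h₁ h₂
    rw [← sub_eq_iff_eq_add] at h₃
    simp only [ι, ρ, F, comp_toLin, id_toLin, LinearMap.add_apply, LinearMap.comp_apply, map_add,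
      map_sub, map_neg, coneFst_coneInl, coneFst_coneInr, coneSnd_coneInl, coneSnd_coneInr,
      coneFst_coneMap, coneSnd_coneMap, coneFst_d, coneSnd_d, map_zero, h₁, h₂, ← h₃]
    abel
  · have := s_eq (coneSnd f x)
    simp only [ι, ρ, comp_toLin, id_toLin, LinearMap.add_apply, LinearMap.comp_apply, map_add,
      map_sub, coneSnd_coneInl, coneSnd_coneInr, coneSnd_coneMap, coneSnd_d, map_neg, map_zero,
      zero_add]
    rw [← neg_inj, neg_sub, this]
    abel

lemma homotopic_comp_coneInlHom : Homotopic (f ≫ coneInlHom f) 0 :=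
  ⟨coneInr f, fun _ _ hm => coneInr_mem f hm, fun m => by simp⟩

lemma homotopic_coneSndHom_comp : Homotopic (coneSndHom f ≫ shiftMap f 1) 0 :=
  ⟨N.toShift 1 ∘ₗ coneFst f, fun i x hx => by
    rw [LinearMap.comp_apply, toShift_mem, sub_add_cancel]
    exact hx.1, fun x => by simp [d_toShift]⟩

lemma exists_comp_homotopic_of_coneSndHom_comp {X Y M : DGModule 𝓐} {F : X ⟶ Y} {g : X ⟶ M}
    (hg : Homotopic (coneSndHom F ≫ shiftMap g 1) 0) : ∃ h : Y ⟶ M, Homotopic (F ≫ h) g := by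
  obtain ⟨s, s_mem, s_eq⟩ := hg
  let s' : (cone F).carrier →ₗ[Aᵐᵒᵖ] M.carrier := M.ofShift 1 ∘ₗ s
  have s'_mem (i : ℤ) (x : (cone F).carrier) (hx : x ∈ (cone F).gr i) : s' x ∈ M.gr i := by
    have := M.ofShift_mem.2 (s_mem i x hx)
    rwa [sub_add_cancel] at this
  have s'_eq (x : (cone F).carrier) :
      Hom.toLin g (coneSnd F x) = -M.d (s' x) + s' ((cone F).d x) := by
    simpa [ofShift_d, s'] using congrArg (M.ofShift 1) (s_eq x)
  refine ⟨⟨s' ∘ₗ coneInl F, fun i y hy => s'_mem i _ (coneInl_mem F hy), fun y => ?_⟩,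
    s' ∘ₗ coneInr F, fun i x hx => s'_mem _ _ (coneInr_mem F hx), fun x => ?_⟩
  · have := s'_eq (coneInl F y)
    rw [coneSnd_coneInl, map_zero, d_coneInl, eq_comm, neg_add_eq_zero] at this
    exact this.symm
  · have := s'_eq (coneInr F x)
    rw [coneSnd_coneInr, d_coneInr, map_sub] at this
    simp only [comp_toLin, LinearMap.comp_apply, this]
    abel

end Cone

end DGModule

/-! ### Simple idempotents and direct summands -/

section SimpleIdempotent

variable {R : Type*} [Ring R]

/-- An idempotent `e` of a ring `R` such that the left ideal `R e` is a simple module. -/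
structure IsSimpleIdempotent (e : R) : Prop where
  isIdempotentElem : IsIdempotentElem e
  isSimpleModule : IsSimpleModule R (Ideal.span {e})

lemma IsSimpleIdempotent.exists_mul_eq {e x : R} (he : IsSimpleIdempotent e) (hx : x * e ≠ 0) :
    ∃ y, y * (x * e) = e := by
  have h_le : Ideal.span {x * e} ≤ Ideal.span {e} :=
    (Ideal.span_singleton_le_iff_mem _).2 (Ideal.mem_span_singleton'.2 ⟨x, rfl⟩)
  have h_eq := ((isSimpleModule_iff_isAtom.1 he.isSimpleModule).le_iff_eq
    (Ideal.span_singleton_eq_bot.not.2 hx)).1 h_le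
  exact Ideal.mem_span_singleton'.1 (h_eq ▸ Ideal.mem_span_singleton_self e)

/-- Schur's lemma: the nonzero homomorphism `R e → R e'`, `x ↦ x * a`, is invertible. -/
lemma IsSimpleIdempotent.exists_inverse {e e' a : R} (he : IsSimpleIdempotent e)
    (he' : IsSimpleIdempotent e') (ha : a ≠ 0) (hea : e * a = a) (hae : a * e' = a) :
    ∃ c, c * a = e' ∧ a * c = e := by
  obtain ⟨y, hy⟩ := he'.exists_mul_eq (x := a) (by rwa [hae])
  rw [hae] at hy
  refine ⟨y * e, by rw [mul_assoc, hea, hy], ?_⟩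
  by_contra h_ne
  have hx : (e - a * y * e) * e = e - a * (y * e) := by
    rw [sub_mul, he.isIdempotentElem.eq, mul_assoc, mul_assoc, he.isIdempotentElem.eq]
  obtain ⟨z, hz⟩ := he.exists_mul_eq (x := e - a * y * e)
    (hx ▸ sub_ne_zero_of_ne (Ne.symm h_ne))
  rw [hx] at hz
  apply ha
  rw [← hea, ← hz, mul_assoc, sub_mul, mul_assoc, mul_assoc, hea, hy, hae, sub_self, mul_zero]

lemma exists_completeOrthogonalIdempotents_isSimpleIdempotent (R : Type*) [Ring R]
    [IsSemisimpleRing R] :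
    ∃ (n : ℕ) (ε : Fin n → R), CompleteOrthogonalIdempotents ε ∧
      ∀ l, IsSimpleIdempotent (ε l) := by
  obtain ⟨s, h_indep, h_top, h_simple⟩ :=
    IsSemisimpleModule.exists_sSupIndep_sSup_simples_eq_top R R
  have h_indep' := (sSupIndep_iff s).1 h_indep
  have h_fin : Finite s := WellFoundedGT.finite_of_iSupIndep h_indep' fun I =>
    (isSimpleModule_iff_isAtom.1 (h_simple I I.2)).1
  obtain ⟨n, ⟨σ⟩⟩ := Finite.exists_equiv_fin s
  let V : Fin n → Ideal R := fun l => (σ.symm l : Ideal R)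
  have h_int : DirectSum.IsInternal V := DirectSum.isInternal_submodule_of_iSupIndep_of_iSup_eq_top
    (h_indep'.comp σ.symm.injective) (by
      rw [← h_top, sSup_eq_iSup', ← σ.symm.iSup_comp])
  let _ : DirectSum.Decomposition V := h_int.chooseDecomposition
  refine ⟨n, DirectSum.idempotent V, DirectSum.completeOrthogonalIdempotents_idempotent V,
    fun l => ⟨DirectSum.isIdempotentElem_idempotent V l, ?_⟩⟩
  have h_span : Ideal.span {DirectSum.idempotent V l} = V l := by
    refine le_antisymm ((Ideal.span_singleton_le_iff_mem _).2 (SetLike.coe_mem _)) fun x hx => ?_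
    rw [Ideal.mem_span_singleton']
    exact ⟨x, by rw [← DirectSum.decompose_eq_mul_idempotent,
      DirectSum.decompose_of_mem_same V hx]⟩
  rw [h_span]
  exact h_simple _ (σ.symm l).2

end SimpleIdempotent

namespace DGModule

/-- The identity of the underlying modules, as a map `A → 𝓐`. -/
def toRegular (𝓐 : DGAlgebra k A) : A →ₗ[Aᵐᵒᵖ] (regular 𝓐).carrier :=
  { toFun := fun a => a, map_add' := fun _ _ => rfl, map_smul' := fun _ _ => rfl }

/-- The identity of the underlying modules, as a map `𝓐 → A`. -/
def ofRegular (𝓐 : DGAlgebra k A) : (regular 𝓐).carrier →ₗ[Aᵐᵒᵖ] A :=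
  { toFun := fun a => a, map_add' := fun _ _ => rfl, map_smul' := fun _ _ => rfl }

@[simp] lemma toRegular_ofRegular (a : (regular 𝓐).carrier) :
    toRegular 𝓐 (ofRegular 𝓐 a) = a := rfl

lemma d_toRegular (a : A) : (regular 𝓐).d (toRegular 𝓐 a) = toRegular 𝓐 (𝓐.d a) := rfl

@[simp] lemma toRegular_mem {i : ℤ} {a : A} :
    toRegular 𝓐 a ∈ (regular 𝓐).gr i ↔ a ∈ 𝓐.gr i := Iff.rfl

@[simp] lemma ofRegular_mem {i : ℤ} {a : (regular 𝓐).carrier} :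
    ofRegular 𝓐 a ∈ 𝓐.gr i ↔ a ∈ (regular 𝓐).gr i := Iff.rfl

/-- A homogeneous idempotent `p` of degree zero on `M` with `(p d)² = 0` on the range of `p`.
It makes the range of `p` a dg module with differential `p d`, although `p` need not commute with
the differential of `M`: this covers subquotients of `M` as well as direct summands. -/
structure Compression (M : DGModule 𝓐) where
  toLin : M.carrier →ₗ[Aᵐᵒᵖ] M.carrier
  idem : ∀ m, toLin (toLin m) = toLin m
  map_mem : ∀ i, ∀ m ∈ M.gr i, toLin m ∈ M.gr i
  d_d : ∀ m, toLin (M.d (toLin (M.d (toLin m)))) = 0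

namespace Compression

variable {M : DGModule 𝓐} (p : Compression M)

/-- The range of `p`, with the differential `p d`. -/
def module : DGModule 𝓐 where
  carrier := p.toLin.range
  gr i := (M.gr i).comap p.toLin.range.subtype.toAddMonoidHom
  gr_indep := by
    intro i
    rw [disjoint_iff_inf_le]
    intro x ⟨hx1, hx2⟩
    have key : (⨆ (j) (_ : j ≠ i), (M.gr j).comap p.toLin.range.subtype.toAddMonoidHom) ≤
        (⨆ (j) (_ : j ≠ i), M.gr j).comap p.toLin.range.subtype.toAddMonoidHom :=
      iSup₂_le fun j hj => AddSubgroup.comap_mono (le_iSup₂ (f := fun j (_ : j ≠ i) => M.gr j) j hj)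
    exact Subtype.ext (AddSubgroup.disjoint_def.mp (M.gr_indep i) hx1 (key hx2))
  gr_iSup := by
    rw [eq_top_iff]
    rintro ⟨_, y, rfl⟩ _
    refine M.homogeneous_induction (P := fun y => p.toLin.rangeRestrict y ∈
      ⨆ i, (M.gr i).comap p.toLin.range.subtype.toAddMonoidHom) ?_ (fun x y hx hy => ?_)
      (fun i x hx => ?_) y
    · rw [map_zero]
      exact zero_mem _
    · rw [map_add]
      exact add_mem hx hy
    · exact (le_iSup (fun i => (M.gr i).comap p.toLin.range.subtype.toAddMonoidHom) i)
        (p.map_mem i x hx)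
  smul_mem i j m hm a ha := M.smul_mem i j m.1 hm a ha
  d := (p.toLin.rangeRestrict.toAddMonoidHom.comp M.d).comp p.toLin.range.subtype.toAddMonoidHom
  d_mem i m hm := p.map_mem _ _ (M.d_mem i m.1 hm)
  d_d m := by
    obtain ⟨_, y, rfl⟩ := m
    exact Subtype.ext (p.d_d y)
  d_smul i m hm a := by
    obtain ⟨_, y, rfl⟩ := m
    refine Subtype.ext ?_
    change p.toLin (M.d (op a • p.toLin y)) = _
    rw [M.d_smul i (p.toLin y) hm a]
    rcases Int.units_eq_one_or i.negOnePow with h | h <;> rw [h] <;> simp [p.idem]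

/-- The inclusion of the range of `p` in `M`. -/
def incl : p.module.carrier →ₗ[Aᵐᵒᵖ] M.carrier := p.toLin.range.subtype

/-- The projection of `M` to the range of `p`. -/
def proj : M.carrier →ₗ[Aᵐᵒᵖ] p.module.carrier := p.toLin.rangeRestrict

@[simp] lemma incl_proj (m : M.carrier) : p.incl (p.proj m) = p.toLin m := rfl

lemma incl_injective : Function.Injective p.incl := Subtype.val_injective

@[simp] lemma toLin_incl (x : p.module.carrier) : p.toLin (p.incl x) = p.incl x := by
  obtain ⟨_, y, rfl⟩ := x
  exact p.idem y

@[simp] lemma proj_incl (x : p.module.carrier) : p.proj (p.incl x) = x :=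
  p.incl_injective (by simp)

lemma incl_mem {i : ℤ} {x : p.module.carrier} (hx : x ∈ p.module.gr i) : p.incl x ∈ M.gr i := hx

lemma proj_mem {i : ℤ} {x : M.carrier} (hx : x ∈ M.gr i) : p.proj x ∈ p.module.gr i :=
  p.map_mem i x hx

lemma module_d (x : p.module.carrier) : p.module.d x = p.proj (M.d (p.incl x)) := rfl

/-- The morphism `p u` to the range of `p`. -/
def factorThru {X : DGModule 𝓐} (u : X ⟶ M)
    (hu : ∀ x, p.toLin (M.d (p.toLin (Hom.toLin u x))) = p.toLin (M.d (Hom.toLin u x))) :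
    X ⟶ p.module where
  toLin := p.proj ∘ₗ Hom.toLin u
  map_mem i x hx := p.proj_mem (Hom.map_mem u i x hx)
  map_d x := p.incl_injective (by simp [module_d, hu, Hom.map_d])

/-- The restriction of a morphism `u` to the range of `p`. -/
def restrict {X : DGModule 𝓐} (u : M ⟶ X)
    (hu : ∀ x, Hom.toLin u (p.toLin (M.d (p.toLin x))) = Hom.toLin u (M.d (p.toLin x))) :
    p.module ⟶ X where
  toLin := Hom.toLin u ∘ₗ p.incl
  map_mem i x hx := Hom.map_mem u i _ (p.incl_mem hx)
  map_d x := by simpa [module_d, Hom.map_d] using hu (p.incl x)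

/-- The compression given by an idempotent endomorphism. -/
def ofIdempotent (π : M ⟶ M) (hπ : π ≫ π = π) : Compression M where
  toLin := Hom.toLin π
  idem m := by rw [← comp_toLin, hπ]
  map_mem := Hom.map_mem π
  d_d m := by simp only [Hom.map_d, M.d_d, map_zero]

lemma isHomotopyRetract_ofIdempotent {π : M ⟶ M} (hπ : π ≫ π = π) (h : Homotopic π (𝟙 M)) :
    IsHomotopyRetract M (ofIdempotent π hπ).module := by
  have h_idem (x : M.carrier) : Hom.toLin π (Hom.toLin π x) = Hom.toLin π x := by
    rw [← comp_toLin, hπ]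
  let p := ofIdempotent π hπ
  let ι : M ⟶ p.module := p.factorThru π fun x => congrArg (fun y => Hom.toLin π (M.d y)) (h_idem x)
  let ρ : p.module ⟶ M := p.restrict π fun x => h_idem _
  have h_comp : ι ≫ ρ = π := hom_ext fun x =>
    (congrArg (Hom.toLin π) (h_idem x)).trans (h_idem x)
  exact ⟨ι, ρ, h_comp.symm ▸ h⟩

end Compression

end DGModule

/-! ### Cell bases -/

open DGModule

/-- A finite cell structure on a dg module `M`: homogeneous generators `v l` with `v l A ≅ e l A`
for simple idempotents `e l` of `A⁰`, such that `M = ⨁ v l A` as a graded module, together with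
the coordinates `M → e l A`. The matrix of the differential has to be strictly upper triangular
only as far as its entries of degrees zero and one are concerned: Gaussian elimination does not
preserve more. -/
structure CellBasis (M : DGModule 𝓐) (ι : Type) [LinearOrder ι] [Fintype ι] where
  deg : ι → ℤ
  e : ι → 𝓐.gr 0
  v : ι → M.carrier
  coord : ι → M.carrier →ₗ[Aᵐᵒᵖ] A
  isSimpleIdempotent_e : ∀ l, IsSimpleIdempotent (e l)
  v_mem : ∀ l, v l ∈ M.gr (deg l)
  coord_mem : ∀ l i, ∀ m ∈ M.gr i, coord l m ∈ 𝓐.gr (i - deg l)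
  coord_self : ∀ l, coord l (v l) = e l
  coord_ne : ∀ l j, l ≠ j → coord l (v j) = 0
  sum_coord : ∀ m, ∑ l, op (coord l m) • v l = m
  triangular : ∀ l j, j ≤ l → (deg l = deg j ∨ deg l = deg j + 1) → coord l (M.d (v j)) = 0

namespace CellBasis

variable {M N : DGModule 𝓐} {ι : Type} [LinearOrder ι] [Fintype ι] (B : CellBasis M ι)

lemma e_mul_coord (l : ι) (m : M.carrier) : B.e l * B.coord l m = B.coord l m := by
  conv_rhs => rw [← B.sum_coord m]
  rw [map_sum, Finset.sum_eq_single_of_mem l (Finset.mem_univ l), map_smul, B.coord_self,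
    op_smul_eq_mul]
  intro j _ hj
  rw [map_smul, B.coord_ne _ _ hj.symm, smul_zero]

lemma smul_v (l : ι) : op (B.e l : A) • B.v l = B.v l := by
  conv_rhs => rw [← B.sum_coord (B.v l)]
  rw [Finset.sum_eq_single_of_mem l (Finset.mem_univ l), B.coord_self]
  intro j _ hj
  rw [B.coord_ne _ _ hj, op_zero, zero_smul]

lemma ext_coord {x y : M.carrier} (h : ∀ l, B.coord l x = B.coord l y) : x = y := by
  rw [← B.sum_coord x, ← B.sum_coord y]
  simp only [h]

lemma linearMap_ext {P : Type*} [AddCommGroup P] [Module Aᵐᵒᵖ P] {f g : M.carrier →ₗ[Aᵐᵒᵖ] P}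
    (h : ∀ l, f (B.v l) = g (B.v l)) : f = g := by
  ext x
  rw [← B.sum_coord x]
  simp only [map_sum, map_smul, h]

/-- The linear map that sends `v l` to `w e l` and the other generators to zero. -/
def single (l : ι) (w : N.carrier) : M.carrier →ₗ[Aᵐᵒᵖ] N.carrier where
  toFun m := op (B.coord l m) • w
  map_add' x y := by rw [map_add, MulOpposite.op_add, add_smul]
  map_smul' r x := by
    obtain ⟨a, rfl⟩ := op_surjective r
    rw [map_smul, op_smul_eq_mul, op_mul, mul_smul, RingHom.id_apply]

lemma single_apply (l : ι) (w : N.carrier) (m : M.carrier) :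
    B.single l w m = op (B.coord l m) • w := rfl

lemma single_of_ne {l j : ι} (h : l ≠ j) (w : N.carrier) : B.single l w (B.v j) = 0 := by
  rw [single_apply, B.coord_ne l j h, op_zero, zero_smul]

lemma single_mem {l : ι} {w : N.carrier} {n : ℤ} (hw : w ∈ N.gr (B.deg l + n)) {i : ℤ}
    {m : M.carrier} (hm : m ∈ M.gr i) : B.single l w m ∈ N.gr (i + n) := by
  have := N.smul_mem _ _ _ hw _ (B.coord_mem l i m hm)
  rwa [show B.deg l + n + (i - B.deg l) = i + n by ring] at this

/-- The matrix of the differential in a basis. -/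
def mat (l j : ι) : A := B.coord l (M.d (B.v j))

lemma mat_mem (l j : ι) : B.mat l j ∈ 𝓐.gr (B.deg j + 1 - B.deg l) :=
  B.coord_mem _ _ _ (M.d_mem _ _ (B.v_mem j))

lemma e_mul_mat (l j : ι) : B.e l * B.mat l j = B.mat l j := B.e_mul_coord _ _

lemma smul_d_v (hd : ∀ a ∈ 𝓐.gr 0, 𝓐.d a = 0) (j : ι) :
    op (B.e j : A) • M.d (B.v j) = M.d (B.v j) := by
  have := M.d_smul _ _ (B.v_mem j) (B.e j)
  rw [B.smul_v, hd _ (B.e j).2, op_zero, zero_smul, smul_zero, add_zero] at this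
  exact this.symm

lemma mat_mul_e (hd : ∀ a ∈ 𝓐.gr 0, 𝓐.d a = 0) (l j : ι) : B.mat l j * B.e j = B.mat l j := by
  rw [mat, ← op_smul_eq_mul, ← map_smul, B.smul_d_v hd]

lemma coord_eq_zero_of_lt (hpos : ∀ i : ℤ, i < 0 → 𝓐.gr i = ⊥) {l : ι} {i : ℤ} {m : M.carrier}
    (hm : m ∈ M.gr i) (h : i < B.deg l) : B.coord l m = 0 := by
  have := B.coord_mem l i m hm
  rwa [hpos _ (by omega), Submodule.mem_bot] at this

lemma deg_le_of_mat_ne_zero (hpos : ∀ i : ℤ, i < 0 → 𝓐.gr i = ⊥) {l j : ι} (h : B.mat l j ≠ 0) :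
    B.deg l ≤ B.deg j + 1 := by
  by_contra! h_lt
  exact h (B.coord_eq_zero_of_lt hpos (M.d_mem _ _ (B.v_mem j)) h_lt)

lemma coord_d_smul_v {l j : ι} (h : l ≠ j) (a : A) :
    B.coord l (M.d (op a • B.v j)) = B.mat l j * a := by
  rw [M.d_smul _ _ (B.v_mem j), map_add, map_smul, op_smul_eq_mul, ← mat, Units.smul_def, map_zsmul,
    map_smul, B.coord_ne l j h, smul_zero, smul_zero, add_zero]

/-- The cell structure on a compression of `M` whose cells are those indexed by `s`. -/
def compress (p : Compression M) (s : Finset ι)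
    (h_compl : ∀ l ∉ s, (∀ x, B.coord l (p.toLin x) = 0) ∨ p.toLin (B.v l) = 0)
    (h_coord : ∀ l ∈ s, ∀ j ∈ s, B.coord l (p.toLin (B.v j)) = B.coord l (B.v j))
    (h_triangular : ∀ l ∈ s, ∀ j ∈ s, j ≤ l → (B.deg l = B.deg j ∨ B.deg l = B.deg j + 1) →
      B.coord l (p.toLin (M.d (p.toLin (B.v j)))) = 0) :
    CellBasis p.module s where
  deg l := B.deg l
  e l := B.e l
  v l := p.proj (B.v l)
  coord l := B.coord l ∘ₗ p.incl
  isSimpleIdempotent_e l := B.isSimpleIdempotent_e l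
  v_mem l := p.proj_mem (B.v_mem l)
  coord_mem l i m hm := B.coord_mem l i _ (p.incl_mem hm)
  coord_self l := (h_coord l l.2 l l.2).trans (B.coord_self l)
  coord_ne l j hlj := (h_coord l l.2 j j.2).trans (B.coord_ne l j (Subtype.coe_ne_coe.2 hlj))
  sum_coord m := by
    conv_rhs => rw [← p.proj_incl m, ← B.sum_coord (p.incl m), map_sum]
    simp only [map_smul, LinearMap.comp_apply]
    rw [Finset.sum_coe_sort s fun l => op (B.coord l (p.incl m)) • p.proj (B.v l)]
    refine Finset.sum_subset (Finset.subset_univ s) fun l _ hl => ?_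
    rcases h_compl l hl with h | h
    · rw [← p.toLin_incl, h, op_zero, zero_smul]
    · have : p.proj (B.v l) = 0 := p.incl_injective (by rw [p.incl_proj, h, map_zero])
      rw [this, smul_zero]
  triangular l j hlj h := h_triangular l l.2 j j.2 hlj h

section Constructions

variable {κ : Type} [LinearOrder κ] [Fintype κ]

/-- The basis of the regular module given by orthogonal idempotents. -/
def regular (hd : ∀ a ∈ 𝓐.gr 0, 𝓐.d a = 0) {n : ℕ} {ε : Fin n → 𝓐.gr 0}
    (hε : CompleteOrthogonalIdempotents ε) (h_simple : ∀ l, IsSimpleIdempotent (ε l)) :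
    CellBasis (DGModule.regular 𝓐) (Fin n) where
  deg _ := 0
  e := ε
  v l := toRegular 𝓐 (ε l)
  coord l := LinearMap.mulLeft Aᵐᵒᵖ (ε l : A) ∘ₗ ofRegular 𝓐
  isSimpleIdempotent_e := h_simple
  v_mem l := (ε l).2
  coord_mem l i a ha := by
    have := SetLike.mul_mem_graded (ε l).2 (ofRegular_mem.2 ha)
    rwa [zero_add, ← sub_zero i] at this
  coord_self l := congrArg Subtype.val (hε.idem l).eq
  coord_ne l j hlj := congrArg Subtype.val (hε.ortho hlj)
  sum_coord a := by
    have h_sum : ∑ l, (ε l : A) = 1 := by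
      simpa using congrArg (𝓐.gr 0).subtype hε.complete
    have h_idem (l : Fin n) : (ε l * ε l : A) = ε l := congrArg Subtype.val (hε.idem l).eq
    simp only [← map_smul, op_smul_eq_mul, ← map_sum, LinearMap.comp_apply,
      LinearMap.mulLeft_apply, ← mul_assoc, h_idem, ← Finset.sum_mul, h_sum, one_mul,
      toRegular_ofRegular]
  triangular l j _ _ := by
    rw [d_toRegular, hd _ (ε j).2, map_zero, map_zero]

/-- The shift of a basis. -/
def shift (B : CellBasis M ι) (n : ℤ) : CellBasis (M.shift n) ι where
  deg l := B.deg l - n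
  e := B.e
  v l := M.toShift n (B.v l)
  coord l := B.coord l ∘ₗ M.ofShift n
  isSimpleIdempotent_e := B.isSimpleIdempotent_e
  v_mem l := by
    rw [toShift_mem, sub_add_cancel]
    exact B.v_mem l
  coord_mem l i m hm := by
    have := B.coord_mem l _ _ (M.ofShift_mem.2 hm)
    rwa [show i + n - B.deg l = i - (B.deg l - n) by ring] at this
  coord_self := B.coord_self
  coord_ne := B.coord_ne
  sum_coord := B.sum_coord
  triangular l j hlj h := by
    have := B.triangular l j hlj (by omega)
    rw [d_toShift, LinearMap.comp_apply, Units.smul_def, map_zsmul, map_zsmul, ofShift_toShift,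
      this, smul_zero]

/-- The basis of a cone. -/
def cone (B : CellBasis M ι) (C : CellBasis N κ) (f : M ⟶ N) :
    CellBasis (DGModule.cone f) (κ ⊕ₗ ι) where
  deg l := Sum.elim C.deg (fun l => B.deg l - 1) (ofLex l)
  e l := Sum.elim C.e B.e (ofLex l)
  v l := Sum.elim (fun l => coneInl f (C.v l)) (fun l => coneInr f (B.v l)) (ofLex l)
  coord l := Sum.elim (fun l => C.coord l ∘ₗ coneFst f) (fun l => B.coord l ∘ₗ coneSnd f) (ofLex l)
  isSimpleIdempotent_e l := by
    cases l using Lex.rec with | _ l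
    rcases l with l | l
    · exact C.isSimpleIdempotent_e l
    · exact B.isSimpleIdempotent_e l
  v_mem l := by
    cases l using Lex.rec with | _ l
    rcases l with l | l
    · exact coneInl_mem f (C.v_mem l)
    · exact coneInr_mem f (B.v_mem l)
  coord_mem l i m hm := by
    cases l using Lex.rec with | _ l
    rcases l with l | l
    · exact C.coord_mem l i _ hm.1
    · have := B.coord_mem l _ _ hm.2
      rwa [show i + 1 - B.deg l = i - (B.deg l - 1) by ring] at this
  coord_self l := by
    cases l using Lex.rec with | _ l
    rcases l with l | l
    · exact C.coord_self l
    · exact B.coord_self l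
  coord_ne l j hlj := by
    cases l using Lex.rec with | _ l
    cases j using Lex.rec with | _ j
    rcases l with l | l <;> rcases j with j | j
    · exact C.coord_ne l j fun h => hlj (by rw [h])
    · exact map_zero (C.coord l)
    · exact map_zero (B.coord l)
    · exact B.coord_ne l j fun h => hlj (by rw [h])
  sum_coord m := by
    rw [← (toLex (α := κ ⊕ ι)).sum_comp, Fintype.sum_sum_type]
    refine cone_ext ?_ ?_
    · simp [C.sum_coord]
    · simp [B.sum_coord]
  triangular l j hlj h := by
    cases l using Lex.rec with | _ l
    cases j using Lex.rec with | _ j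
    rcases l with l | l <;> rcases j with j | j
    · simpa using C.triangular l j (by simpa using hlj) (by simpa using h)
    · exact absurd hlj (by simp)
    · simp
    · have := B.triangular l j (by simpa using hlj) (by simp at h; omega)
      simpa using this

end Constructions

end CellBasis

/-! ### Minimal cell bases -/

lemma DGModule.id_sub_nullHom_idem {M : DGModule 𝓐} {h : M.carrier →ₗ[Aᵐᵒᵖ] M.carrier}
    (hh : ∀ i, ∀ m ∈ M.gr i, h m ∈ M.gr (i - 1)) (h_h : ∀ x, h (h x) = 0)
    (h_d_h : ∀ x, h (M.d (h x)) = h x) :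
    (𝟙 M - nullHom h hh) ≫ (𝟙 M - nullHom h hh) = 𝟙 M - nullHom h hh := by
  rw [Preadditive.comp_sub, Category.comp_id, sub_eq_self]
  refine hom_ext fun x => ?_
  simp only [comp_toLin, sub_toLin, id_toLin, nullHom_toLin, zero_toLin, map_sub, map_add, h_h,
    h_d_h, M.d_d, map_zero]
  abel

namespace CellBasis

variable {M N : DGModule 𝓐} {ι : Type} [LinearOrder ι] [Fintype ι] (B : CellBasis M ι)

/-- A basis is minimal if the matrix of the differential has no entries in `A⁰`. -/
def IsMinimal (B : CellBasis M ι) : Prop := ∀ l j, B.deg l = B.deg j + 1 → B.mat l j = 0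

/-- An invertible entry, in row `j` and column `i`, of the matrix of the differential. It is the
first nonzero entry of degree zero in its row and the last one in its column, which ensures that
its elimination preserves triangularity. -/
structure Pivot (B : CellBasis M ι) where
  i : ι
  j : ι
  c : 𝓐.gr 0
  deg_j : B.deg j = B.deg i + 1
  c_mul_mat : c * B.mat j i = B.e i
  mat_mul_c : B.mat j i * c = B.e j
  i_le : ∀ m, B.deg j = B.deg m + 1 → B.mat j m ≠ 0 → i ≤ m
  le_j : ∀ l, B.deg l = B.deg i + 1 → B.mat l i ≠ 0 → l ≤ j

lemma exists_mat_inverse (hd : ∀ a ∈ 𝓐.gr 0, 𝓐.d a = 0) {i j : ι} (h_deg : B.deg j = B.deg i + 1)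
    (h_mat : B.mat j i ≠ 0) :
    ∃ c : 𝓐.gr 0, c * B.mat j i = B.e i ∧ B.mat j i * c = B.e j := by
  have h_mem := B.mat_mem j i
  rw [← h_deg, sub_self] at h_mem
  let a : 𝓐.gr 0 := ⟨B.mat j i, h_mem⟩
  have h_left : B.e j * a = a := Subtype.ext (B.e_mul_mat j i)
  have h_right : a * B.e i = a := Subtype.ext (B.mat_mul_e hd j i)
  obtain ⟨c, h₁, h₂⟩ := (B.isSimpleIdempotent_e j).exists_inverse (B.isSimpleIdempotent_e i)
    (fun h => h_mat (congrArg Subtype.val h)) h_left h_right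
  exact ⟨c, congrArg Subtype.val h₁, congrArg Subtype.val h₂⟩

lemma exists_pivot (hd : ∀ a ∈ 𝓐.gr 0, 𝓐.d a = 0) (hB : ¬ B.IsMinimal) : Nonempty B.Pivot := by
  classical
  simp only [IsMinimal, not_forall] at hB
  obtain ⟨j₀, i₀, h_deg₀, h_mat₀⟩ := hB
  obtain ⟨i, hi, h_min⟩ := Finset.exists_min_image
    (Finset.univ.filter fun i => ∃ j, B.deg j = B.deg i + 1 ∧ B.mat j i ≠ 0) id
    ⟨i₀, by simpa using ⟨j₀, h_deg₀, h_mat₀⟩⟩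
  obtain ⟨j₁, h₁⟩ := (Finset.mem_filter.1 hi).2
  obtain ⟨j, hj, h_max⟩ := Finset.exists_max_image
    (Finset.univ.filter fun j => B.deg j = B.deg i + 1 ∧ B.mat j i ≠ 0) id ⟨j₁, by simpa using h₁⟩
  obtain ⟨h_deg, h_mat⟩ := (Finset.mem_filter.1 hj).2
  obtain ⟨c, hc, hc'⟩ := B.exists_mat_inverse hd h_deg h_mat
  exact ⟨⟨i, j, c, h_deg, hc, hc',
    fun m hm hm' => h_min m (Finset.mem_filter.2 ⟨Finset.mem_univ m, j, hm, hm'⟩),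
    fun l hl hl' => h_max l (Finset.mem_filter.2 ⟨Finset.mem_univ l, hl, hl'⟩)⟩⟩

namespace Pivot

variable {B} (P : B.Pivot)

lemma i_ne_j : P.i ≠ P.j := fun h => by
  have := P.deg_j
  rw [← h] at this
  omega

/-- The homotopy that cancels the cells `i` and `j` against each other. -/
def homotopy : M.carrier →ₗ[Aᵐᵒᵖ] M.carrier := B.single P.j (op (P.c : A) • B.v P.i)

lemma homotopy_apply (x : M.carrier) : P.homotopy x = op (P.c * B.coord P.j x) • B.v P.i := by
  rw [homotopy, single_apply, smul_smul, op_mul]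

lemma homotopy_mem (n : ℤ) (m : M.carrier) (hm : m ∈ M.gr n) : P.homotopy m ∈ M.gr (n - 1) := by
  refine B.single_mem (n := -1) ?_ hm
  have := M.smul_mem _ _ _ (B.v_mem P.i) _ P.c.2
  rwa [show B.deg P.i + 0 = B.deg P.j + -1 by have := P.deg_j; omega] at this

lemma homotopy_v {l : ι} (hl : l ≠ P.j) : P.homotopy (B.v l) = 0 := B.single_of_ne hl.symm _

lemma coord_homotopy {l : ι} (hl : l ≠ P.i) (x : M.carrier) : B.coord l (P.homotopy x) = 0 := by
  rw [homotopy_apply, map_smul, B.coord_ne _ _ hl, smul_zero]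

lemma coord_d_homotopy {l : ι} (hl : l ≠ P.i) (x : M.carrier) :
    B.coord l (M.d (P.homotopy x)) = B.mat l P.i * (P.c * B.coord P.j x) := by
  rw [homotopy_apply, B.coord_d_smul_v hl]

lemma coord_j_d_homotopy (x : M.carrier) :
    B.coord P.j (M.d (P.homotopy x)) = B.coord P.j x := by
  rw [P.coord_d_homotopy P.i_ne_j.symm, ← mul_assoc, P.mat_mul_c, B.e_mul_coord]

lemma homotopy_homotopy (x : M.carrier) : P.homotopy (P.homotopy x) = 0 := by
  rw [homotopy_apply, P.coord_homotopy P.i_ne_j.symm, mul_zero, op_zero, zero_smul]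

lemma homotopy_d_homotopy (x : M.carrier) : P.homotopy (M.d (P.homotopy x)) = P.homotopy x := by
  rw [homotopy_apply, coord_j_d_homotopy, ← homotopy_apply]

/-- The projection to a complement of the contractible submodule spanned by `v i` and `d (v i)`. -/
def projection : M ⟶ M := 𝟙 M - nullHom P.homotopy P.homotopy_mem

lemma projection_toLin (x : M.carrier) :
    Hom.toLin P.projection x = x - (M.d (P.homotopy x) + P.homotopy (M.d x)) := by
  rw [projection, sub_toLin, id_toLin, nullHom_toLin]

lemma projection_idem : P.projection ≫ P.projection = P.projection :=
  id_sub_nullHom_idem P.homotopy_mem P.homotopy_homotopy P.homotopy_d_homotopy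

lemma projection_v {l : ι} (hl : l ≠ P.j) :
    Hom.toLin P.projection (B.v l) = B.v l - P.homotopy (M.d (B.v l)) := by
  rw [projection_toLin, P.homotopy_v hl, map_zero, zero_add]

lemma projection_v_i : Hom.toLin P.projection (B.v P.i) = 0 := by
  rw [P.projection_v P.i_ne_j, homotopy_apply, ← mat, P.c_mul_mat, B.smul_v, sub_self]

lemma coord_j_projection (x : M.carrier) : B.coord P.j (Hom.toLin P.projection x) = 0 := by
  rw [projection_toLin, map_sub, map_add, coord_j_d_homotopy, P.coord_homotopy P.i_ne_j.symm,
    add_zero, sub_self]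

lemma coord_projection_v {l m : ι} (hl : l ≠ P.i) (hm : m ≠ P.j) :
    B.coord l (Hom.toLin P.projection (B.v m)) = B.coord l (B.v m) := by
  rw [P.projection_v hm, map_sub, P.coord_homotopy hl, sub_zero]

lemma coord_d_projection_v {l m : ι} (hl : l ≠ P.i) (hm : m ≠ P.j) :
    B.coord l (M.d (Hom.toLin P.projection (B.v m))) =
      B.mat l m - B.mat l P.i * (P.c * B.mat P.j m) := by
  rw [P.projection_v hm, map_sub, map_sub, P.coord_d_homotopy hl]
  rfl

lemma mat_mul_mat_eq_zero (hpos : ∀ i : ℤ, i < 0 → 𝓐.gr i = ⊥) {l m : ι} (hml : m ≤ l)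
    (h_deg : B.deg l = B.deg m ∨ B.deg l = B.deg m + 1) :
    B.mat l P.i * (P.c * B.mat P.j m) = 0 := by
  by_contra h_ne
  have hl : B.mat l P.i ≠ 0 := fun h => h_ne (by rw [h, zero_mul])
  have hm : B.mat P.j m ≠ 0 := fun h => h_ne (by rw [h, mul_zero, mul_zero])
  have hl_deg := B.deg_le_of_mat_ne_zero hpos hl
  have hm_deg := B.deg_le_of_mat_ne_zero hpos hm
  have hi := P.i_le m
  have hj := P.le_j l
  have hij := P.deg_j
  have h_lt {l j : ι} (h : B.mat l j ≠ 0) (h_deg : B.deg l = B.deg j ∨ B.deg l = B.deg j + 1) :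
      l < j := not_le.1 fun h_le => h (B.triangular l j h_le h_deg)
  rcases eq_or_ne (B.deg l) (B.deg P.i + 1) with h | h
  · rcases h_deg with h_deg | h_deg
    · exact hml.not_gt ((hj h hl).trans_lt (h_lt hm (.inl (by omega))))
    · exact hml.not_gt ((h_lt hl (.inr h)).trans_le (hi (by omega) hm))
  · exact hml.not_gt ((h_lt hl (.inl (by omega))).trans_le (hi (by omega) hm))

/-- The cell structure in which the cells `i` and `j` have been cancelled. -/
def eliminate (hpos : ∀ i : ℤ, i < 0 → 𝓐.gr i = ⊥) :
    CellBasis (Compression.ofIdempotent P.projection P.projection_idem).module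
      ({P.i, P.j}ᶜ : Finset ι) :=
  B.compress _ _
    (fun l hl => by
      rw [Finset.notMem_compl, Finset.mem_insert, Finset.mem_singleton] at hl
      rcases hl with rfl | rfl
      exacts [.inr P.projection_v_i, .inl P.coord_j_projection])
    (fun l hl j hj => P.coord_projection_v (by simp_all) (by simp_all))
    (fun l hl m hm hml h_deg => by
      have h_idem (x : M.carrier) :
          Hom.toLin P.projection (Hom.toLin P.projection x) = Hom.toLin P.projection x := by
        rw [← comp_toLin, P.projection_idem]
      change B.coord l (Hom.toLin P.projection (M.d (Hom.toLin P.projection (B.v m)))) = 0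
      rw [Hom.map_d, h_idem, P.coord_d_projection_v (by simp_all) (by simp_all), mat,
        B.triangular l m hml h_deg, P.mat_mul_mat_eq_zero hpos hml h_deg, sub_zero])

end Pivot

lemma exists_isMinimal (hpos : ∀ i : ℤ, i < 0 → 𝓐.gr i = ⊥) (hd : ∀ a ∈ 𝓐.gr 0, 𝓐.d a = 0)
    (B : CellBasis M ι) : ∃ (N : DGModule 𝓐) (κ : Type) (_ : LinearOrder κ) (_ : Fintype κ)
      (C : CellBasis N κ),
      IsHomotopyRetract M N ∧ C.IsMinimal ∧ Set.range C.deg ⊆ Set.range B.deg := by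
  induction hn : Fintype.card ι using Nat.strong_induction_on generalizing ι M with
  | _ n ih =>
    by_cases hB : B.IsMinimal
    · exact ⟨M, ι, _, _, B, .refl M, hB, subset_rfl⟩
    · obtain ⟨P⟩ := B.exists_pivot hd hB
      have h_card : Fintype.card ({P.i, P.j}ᶜ : Finset ι) < n := by
        rw [Fintype.card_coe, ← hn]
        exact Finset.card_lt_univ_of_notMem (x := P.i) (by simp)
      obtain ⟨N, κ, _, _, C, h_retract, hC, h_deg⟩ := ih _ h_card (P.eliminate hpos) rfl
      have h_homotopic : Homotopic P.projection (𝟙 M) :=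
        (homotopic_sub_nullHom (𝟙 M) P.homotopy P.homotopy_mem).symm
      refine ⟨N, κ, _, _, C, .trans
        (Compression.isHomotopyRetract_ofIdempotent P.projection_idem h_homotopic) h_retract, hC,
        h_deg.trans ?_⟩
      rintro _ ⟨l, rfl⟩
      exact ⟨l, rfl⟩

end CellBasis

/-- Every perfect dg module is a homotopy retract of one with a finite cell basis. -/
lemma IsPerfect.exists_cellBasis (hss : IsSemisimpleRing ↥(𝓐.gr 0))
    (hd : ∀ a ∈ 𝓐.gr 0, 𝓐.d a = 0) {X : DGHot 𝓐} (hX : IsPerfect 𝓐 X) :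
    ∃ (N : DGModule 𝓐) (κ : Type) (_ : LinearOrder κ) (_ : Fintype κ) (_ : CellBasis N κ),
      IsHomotopyRetract X.as N := by
  induction hX with
  | regular =>
    obtain ⟨n, ε, hε, h_simple⟩ :=
      exists_completeOrthogonalIdempotents_isSimpleIdempotent (𝓐.gr 0)
    exact ⟨_, Fin n, _, _, CellBasis.regular hd hε h_simple, .refl _⟩
  | shift M n _ ih =>
    obtain ⟨N, κ, _, _, B, h⟩ := ih
    exact ⟨_, κ, _, _, B.shift n, h.shift n⟩
  | @cone M N f _ _ ih₁ ih₂ =>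
    obtain ⟨P, ι, _, _, B, i, r, h⟩ := ih₁
    obtain ⟨P', κ, _, _, C, i', r', h'⟩ := ih₂
    exact ⟨_, _, _, _, B.cone C (r ≫ f ≫ i'), isHomotopyRetract_cone f h h'⟩
  | @retract X Y ρ _ ih =>
    obtain ⟨N, κ, _, _, B, h⟩ := ih
    exact ⟨N, κ, _, _, B, (isHomotopyRetract_of_retract ρ).trans h⟩

/-! ### The degree filtration -/

lemma subsingleton_gradedCohomology_iff {V : Type u} [AddCommGroup V] (gr : ℤ → AddSubgroup V)
    (d : V →+ V) (i : ℤ) : Subsingleton (gradedCohomology gr d i) ↔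
      ∀ x ∈ gr i, d x = 0 → ∃ y ∈ gr (i - 1), d y = x := by
  constructor
  · intro h x hx hdx
    let x' : ↥(gr i ⊓ d.ker) := ⟨x, hx, hdx⟩
    exact AddSubgroup.mem_addSubgroupOf.1 <| (QuotientAddGroup.eq_zero_iff
      (N := ((gr (i - 1)).map d).addSubgroupOf (gr i ⊓ d.ker)) x').1 (Subsingleton.elim _ _)
  · intro h
    refine subsingleton_of_forall_eq 0 fun q => ?_
    obtain ⟨⟨x, hx, hdx⟩, rfl⟩ := QuotientAddGroup.mk_surjective q
    exact (QuotientAddGroup.eq_zero_iff _).2 (AddSubgroup.mem_addSubgroupOf.2 (h x hx hdx))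

namespace DGModule

variable {M N : DGModule 𝓐}

lemma smul_mem_mulAugmentation {j : ℤ} {a : A} (hj : 0 < j) (ha : a ∈ 𝓐.gr j) (m : M.carrier) :
    op a • m ∈ M.mulAugmentation := by
  induction m using M.homogeneous_induction with
  | zero => rw [smul_zero]; exact zero_mem _
  | add x y hx hy => rw [smul_add]; exact add_mem hx hy
  | mem i x hx => exact AddSubgroup.subset_closure ⟨i, j, x, a, hx, hj, ha, rfl⟩

lemma smul_mem_mulAugmentation_of_nonneg {j : ℤ} {a : A} (hj : 0 ≤ j) (ha : a ∈ 𝓐.gr j)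
    {m : M.carrier} (hm : m ∈ M.mulAugmentation) : op a • m ∈ M.mulAugmentation := by
  suffices M.mulAugmentation ≤ M.mulAugmentation.comap (DistribSMul.toAddMonoidHom _ (op a))
    from this hm
  refine (AddSubgroup.closure_le _).2 ?_
  rintro _ ⟨i, n, m, b, -, hn, hb, rfl⟩
  change op a • op b • m ∈ M.mulAugmentation
  rw [smul_smul, ← op_mul]
  exact smul_mem_mulAugmentation (by omega) (SetLike.mul_mem_graded hb ha) m

lemma map_mem_mulAugmentation (φ : M.carrier →ₗ[Aᵐᵒᵖ] N.carrier) {m : M.carrier}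
    (hm : m ∈ M.mulAugmentation) : φ m ∈ N.mulAugmentation := by
  suffices M.mulAugmentation ≤ N.mulAugmentation.comap φ.toAddMonoidHom from this hm
  refine (AddSubgroup.closure_le _).2 ?_
  rintro _ ⟨i, j, m, a, -, hj, ha, rfl⟩
  change φ (op a • m) ∈ N.mulAugmentation
  rw [map_smul]
  exact smul_mem_mulAugmentation hj ha _

lemma notMem_barSupport_iff {i : ℤ} : i ∉ M.barSupport ↔
    ∀ m ∈ M.gr i, M.d m ∈ M.mulAugmentation →
      ∃ m' ∈ M.gr (i - 1), m - M.d m' ∈ M.mulAugmentation := by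
  have h_eq (m m' : M.carrier) : M.barD (QuotientAddGroup.mk' _ m') = QuotientAddGroup.mk' _ m ↔
      m - M.d m' ∈ M.mulAugmentation := by
    rw [← neg_add_eq_sub]
    exact QuotientAddGroup.eq
  rw [barSupport, Set.mem_ofPred_eq, not_nontrivial_iff_subsingleton,
    subsingleton_gradedCohomology_iff]
  constructor
  · intro h m hm hdm
    obtain ⟨_, ⟨m', hm', rfl⟩, h'⟩ := h (QuotientAddGroup.mk' _ m) ⟨m, hm, rfl⟩
      ((QuotientAddGroup.eq_zero_iff _).2 hdm)
    exact ⟨m', hm', (h_eq m m').1 h'⟩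
  · rintro h _ ⟨m, hm, rfl⟩ hdm
    obtain ⟨m', hm', h'⟩ := h m hm ((QuotientAddGroup.eq_zero_iff _).1 hdm)
    exact ⟨_, ⟨m', hm', rfl⟩, (h_eq m m').2 h'⟩

end DGModule

namespace CellBasis

variable {M X : DGModule 𝓐} {ι : Type} [LinearOrder ι] [Fintype ι] (B : CellBasis M ι)

section Filtration

/-- The submodule generated by the basis elements of degree at most `q`. -/
def filt (q : ℤ) : Submodule Aᵐᵒᵖ M.carrier := ⨅ (l) (_ : q < B.deg l), (B.coord l).ker

variable {B}

lemma mem_filt {q : ℤ} {m : M.carrier} : m ∈ B.filt q ↔ ∀ l, q < B.deg l → B.coord l m = 0 := by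
  simp [filt, Submodule.mem_iInf]

lemma v_mem_filt {q : ℤ} {l : ι} (hl : B.deg l ≤ q) : B.v l ∈ B.filt q :=
  mem_filt.2 fun j hj => B.coord_ne j l (by rintro rfl; omega)

lemma map_eq_zero_of_mem_filt {P : Type*} [AddCommGroup P] [Module Aᵐᵒᵖ P]
    {φ : M.carrier →ₗ[Aᵐᵒᵖ] P} {q : ℤ} (hφ : ∀ l, B.deg l ≤ q → φ (B.v l) = 0) {m : M.carrier}
    (hm : m ∈ B.filt q) : φ m = 0 := by
  rw [← B.sum_coord m, map_sum]
  refine Finset.sum_eq_zero fun l _ => ?_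
  rw [map_smul]
  rcases le_or_gt (B.deg l) q with h | h
  · rw [hφ l h, smul_zero]
  · rw [mem_filt.1 hm l h, op_zero, zero_smul]

variable (B)

/-- The projection to the span of the basis elements of degree `q`. -/
def component (q : ℤ) : M.carrier →ₗ[Aᵐᵒᵖ] M.carrier :=
  ∑ l with B.deg l = q, B.single l (B.v l)

lemma coord_component (q : ℤ) (l : ι) (m : M.carrier) :
    B.coord l (B.component q m) = if B.deg l = q then B.coord l m else 0 := by
  have h_coord (j : ι) : B.coord l (B.single j (B.v j) m) = if l = j then B.coord l m else 0 := by
    rw [single_apply, map_smul, op_smul_eq_mul]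
    split_ifs with h
    · rw [← h, B.coord_self, B.e_mul_coord]
    · rw [B.coord_ne l j h, zero_mul]
  simp [component, h_coord]

lemma component_component (q : ℤ) (m : M.carrier) :
    B.component q (B.component q m) = B.component q m :=
  B.ext_coord fun l => by simp only [coord_component]; split_ifs <;> rfl

lemma component_mem (q : ℤ) {i : ℤ} {m : M.carrier} (hm : m ∈ M.gr i) :
    B.component q m ∈ M.gr i := by
  rw [component, LinearMap.sum_apply]
  refine sum_mem fun l _ => ?_
  simpa using B.single_mem (n := 0) (by simpa using B.v_mem l) hm

lemma component_mem_filt (q : ℤ) (m : M.carrier) : B.component q m ∈ B.filt q :=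
  mem_filt.2 fun l hl => by rw [coord_component, if_neg hl.ne']

variable {B}

lemma sub_component_mem_filt {q : ℤ} {m : M.carrier} (hm : m ∈ B.filt q) :
    m - B.component q m ∈ B.filt (q - 1) := mem_filt.2 fun l hl => by
  rw [map_sub, coord_component]
  split_ifs with h
  · rw [sub_self]
  · rw [sub_zero, mem_filt.1 hm l (by omega)]

lemma component_eq_zero {q : ℤ} {m : M.carrier} (hm : m ∈ B.filt (q - 1)) :
    B.component q m = 0 := B.ext_coord fun l => by
  rw [coord_component, map_zero]
  split_ifs with h
  · exact mem_filt.1 hm l (by omega)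
  · rfl

lemma exists_iterate_mem_filt {f : M.carrier → M.carrier}
    (hf : ∀ q ≠ 0, ∀ m ∈ B.filt q, f m ∈ B.filt (q - 1)) :
    ∃ n, (∀ m, f^[n] m ∈ B.filt 0) ∧ ∀ m ∈ B.filt (0 - 1), f^[n] m = 0 := by
  have h_pos (n : ℕ) : ∀ m ∈ B.filt n, f^[n] m ∈ B.filt 0 := by
    induction n with
    | zero => exact fun m hm => hm
    | succ n ih =>
      intro m hm
      have := hf _ (by omega) m hm
      rw [Nat.cast_succ, add_sub_cancel_right] at this
      exact ih _ this
  have h_neg (n : ℕ) (m : M.carrier) (hm : m ∈ B.filt (0 - 1)) : f^[n] m ∈ B.filt (-1 - n) := by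
    induction n with
    | zero => simpa using hm
    | succ n ih =>
      rw [Function.iterate_succ_apply', Nat.cast_succ, ← sub_sub]
      exact hf _ (by omega) _ ih
  obtain ⟨b, hb⟩ := (Set.finite_range fun l => (B.deg l).natAbs).bddAbove
  have h_deg (l : ι) : (B.deg l).natAbs ≤ b := hb ⟨l, rfl⟩
  refine ⟨b, fun m => h_pos b m (mem_filt.2 fun l hl => ?_), fun m hm => B.ext_coord fun l => ?_⟩
  · have := h_deg l
    omega
  · rw [map_zero]
    refine mem_filt.1 (h_neg b m hm) l ?_
    have := h_deg l
    omega

end Filtration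

lemma coord_eq_zero_of_mem_mulAugmentation (hpos : ∀ i : ℤ, i < 0 → 𝓐.gr i = ⊥) {l : ι}
    {m : M.carrier} (hm : m ∈ M.gr (B.deg l)) (hm' : m ∈ M.mulAugmentation) :
    B.coord l m = 0 := by
  let P : M.carrier →+ A := (GradedRing.proj 𝓐.gr 0).comp (B.coord l).toAddMonoidHom
  have h_le : M.mulAugmentation ≤ P.ker := by
    refine (AddSubgroup.closure_le _).2 ?_
    rintro _ ⟨i, j, x, a, hx, hj, ha, rfl⟩
    change GradedRing.proj 𝓐.gr 0 (B.coord l (op a • x)) = 0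
    rw [map_smul, op_smul_eq_mul, GradedRing.proj_apply]
    rcases lt_or_ge i (B.deg l) with h | h
    · rw [B.coord_eq_zero_of_lt hpos hx h, zero_mul, DirectSum.decompose_zero]
      rfl
    · exact DirectSum.decompose_of_mem_ne _ (SetLike.mul_mem_graded (B.coord_mem l i x hx) ha)
        (by omega)
  have h_coord := B.coord_mem l _ m hm
  rw [sub_self] at h_coord
  have h_proj : GradedRing.proj 𝓐.gr 0 (B.coord l m) = 0 := h_le hm'
  rwa [GradedRing.proj_apply, DirectSum.decompose_of_mem_same _ h_coord] at h_proj

namespace IsMinimal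

variable {B} (hpos : ∀ i : ℤ, i < 0 → 𝓐.gr i = ⊥) (hB : B.IsMinimal)
include hpos hB

lemma deg_le {l j : ι} (h : B.mat l j ≠ 0) : B.deg l ≤ B.deg j :=
  Int.lt_add_one_iff.1 <|
    lt_of_le_of_ne (B.deg_le_of_mat_ne_zero hpos h) fun h_eq => h (hB l j h_eq)

lemma d_v_mem_mulAugmentation (l : ι) : M.d (B.v l) ∈ M.mulAugmentation := by
  rw [← B.sum_coord (M.d (B.v l))]
  refine sum_mem fun j _ => ?_
  rw [← mat]
  rcases eq_or_ne (B.mat j l) 0 with h | h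
  · rw [h, op_zero, zero_smul]
    exact zero_mem _
  · have := hB.deg_le hpos h
    exact smul_mem_mulAugmentation (by omega) (B.mat_mem j l) _

lemma d_mem_mulAugmentation (m : M.carrier) : M.d m ∈ M.mulAugmentation := by
  induction m using M.homogeneous_induction with
  | zero => rw [map_zero]; exact zero_mem _
  | add x y hx hy => rw [map_add]; exact add_mem hx hy
  | mem i m hm => ?_
  rw [← B.sum_coord m, map_sum]
  refine sum_mem fun l _ => ?_
  rcases lt_or_ge i (B.deg l) with h | h
  · rw [B.coord_eq_zero_of_lt hpos hm h, op_zero, zero_smul, map_zero]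
    exact zero_mem _
  rw [M.d_smul _ _ (B.v_mem l), Units.smul_def]
  have h_coord := B.coord_mem l i m hm
  exact add_mem
    (smul_mem_mulAugmentation_of_nonneg (by omega) h_coord (hB.d_v_mem_mulAugmentation hpos l))
    (zsmul_mem (smul_mem_mulAugmentation (by omega) (𝓐.d_mem _ _ h_coord) _) _)

lemma d_mem_filt {q : ℤ} {m : M.carrier} (hm : m ∈ B.filt q) : M.d m ∈ B.filt q := by
  refine mem_filt.2 fun l hl => ?_
  rw [← B.sum_coord m, map_sum, map_sum]
  refine Finset.sum_eq_zero fun j _ => ?_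
  rcases le_or_gt (B.deg j) q with hj | hj
  · have h_mat : B.mat l j = 0 := by
      by_contra h
      exact ((hB.deg_le hpos h).trans hj).not_gt hl
    rw [B.coord_d_smul_v (by rintro rfl; omega), h_mat, zero_mul]
  · rw [mem_filt.1 hm j hj, op_zero, zero_smul, map_zero, map_zero]

lemma component_d_component {q : ℤ} {m : M.carrier} (hm : m ∈ B.filt q) :
    B.component q (M.d (B.component q m)) = B.component q (M.d m) := by
  have := component_eq_zero (hB.d_mem_filt hpos (sub_component_mem_filt hm))
  rw [map_sub, map_sub, sub_eq_zero] at this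
  exact this.symm

/-- The subquotient spanned by the basis elements of degree `q`. -/
def slice (q : ℤ) : Compression M where
  toLin := B.component q
  idem := B.component_component q
  map_mem _ _ hm := B.component_mem q hm
  d_d m := by
    rw [hB.component_d_component hpos (hB.d_mem_filt hpos (B.component_mem_filt q m)), M.d_d,
      map_zero]

/-- The basis of the subquotient spanned by the basis elements of degree `q`. -/
def sliceBasis (q : ℤ) :
    CellBasis (hB.slice hpos q).module (Finset.univ.filter fun l => B.deg l = q) :=
  B.compress _ _
    (fun l hl => .inl fun m => (B.coord_component q l m).trans (if_neg (by simpa using hl)))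
    (fun l hl _ _ => (B.coord_component q l _).trans (if_pos (Finset.mem_filter.1 hl).2))
    (fun l _ j hj hjl h => by
      change B.coord l (B.component q (M.d (B.component q (B.v j)))) = 0
      rw [hB.component_d_component hpos (v_mem_filt (Finset.mem_filter.1 hj).2.le),
        coord_component, B.triangular l j hjl h, ite_self])

lemma coord_map_v_eq_zero {l j : ι} (h_deg : B.deg l = B.deg j) (hX : B.deg j ∉ X.barSupport)
    (r : M ⟶ X) (i : X ⟶ M) : B.coord l (Hom.toLin i (Hom.toLin r (B.v j))) = 0 := by
  obtain ⟨x, -, hx'⟩ := notMem_barSupport_iff.1 hX _ (Hom.map_mem r _ _ (B.v_mem j)) (by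
    rw [← Hom.map_d r]
    exact map_mem_mulAugmentation (Hom.toLin r) (hB.d_mem_mulAugmentation hpos _))
  refine B.coord_eq_zero_of_mem_mulAugmentation hpos
    (h_deg ▸ Hom.map_mem i _ _ (Hom.map_mem r _ _ (B.v_mem j))) ?_
  have h_sub := map_mem_mulAugmentation (Hom.toLin i) hx'
  rw [map_sub, Hom.map_d i] at h_sub
  rw [← sub_add_cancel (Hom.toLin i _) (M.d (Hom.toLin i x))]
  exact add_mem h_sub (hB.d_mem_mulAugmentation hpos _)

lemma map_mem_filt (hX : X.barSupport ⊆ {0}) (r : M ⟶ X) (i : X ⟶ M) {q : ℤ} (hq : q ≠ 0)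
    {m : M.carrier} (hm : m ∈ B.filt q) : Hom.toLin (r ≫ i) m ∈ B.filt (q - 1) := by
  refine mem_filt.2 fun l hl =>
    map_eq_zero_of_mem_filt (φ := B.coord l ∘ₗ Hom.toLin (r ≫ i)) (fun j hj => ?_) hm
  rcases lt_or_ge (B.deg j) (B.deg l) with h | h
  · exact B.coord_eq_zero_of_lt hpos (Hom.map_mem (r ≫ i) _ _ (B.v_mem j)) h
  · have h_deg : B.deg j = q := by omega
    exact hB.coord_map_v_eq_zero hpos (by omega) (fun h => hq (h_deg ▸ hX h)) r i

end IsMinimal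

end CellBasis

lemma DGModule.exists_iterate_homotopic {X Y : DGModule 𝓐} {i : X ⟶ Y} {r : Y ⟶ X}
    (h : Homotopic (i ≫ r) (𝟙 X)) (n : ℕ) :
    ∃ ψ : Y ⟶ Y, (∀ y, Hom.toLin ψ y = (Hom.toLin (r ≫ i))^[n] y) ∧
      Homotopic (i ≫ ψ) i ∧ Homotopic (ψ ≫ r) r := by
  induction n with
  | zero =>
    refine ⟨𝟙 Y, fun _ => rfl, ?_, ?_⟩
    · rw [Category.comp_id]
      exact .refl i
    · rw [Category.id_comp]
      exact .refl r
  | succ n ih =>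
    obtain ⟨ψ, h_iterate, h_left, h_right⟩ := ih
    refine ⟨(r ≫ i) ≫ ψ, fun y => h_iterate _, ?_, ?_⟩
    · have := h.comp_right (i ≫ ψ)
      rw [Category.id_comp] at this
      simpa only [Category.assoc] using this.trans h_left
    · have := h.comp_left r
      rw [Category.comp_id] at this
      simpa only [Category.assoc] using (h_right.comp_left (r ≫ i)).trans <| by
        simpa only [Category.assoc] using this

lemma exists_cellBasis_deg_zero (hpos : ∀ i : ℤ, i < 0 → 𝓐.gr i = ⊥)
    (hss : IsSemisimpleRing ↥(𝓐.gr 0)) (hd : ∀ a ∈ 𝓐.gr 0, 𝓐.d a = 0) {X : DGHot 𝓐}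
    (hX : perfectSupportedIn 𝓐 {0} X) :
    ∃ (N : DGModule 𝓐) (κ : Type) (_ : LinearOrder κ) (_ : Fintype κ) (C : CellBasis N κ),
      (∀ l, C.deg l = 0) ∧ IsHomotopyRetract X.as N := by
  obtain ⟨N₀, κ₀, _, _, B₀, hN₀⟩ := hX.1.exists_cellBasis hss hd
  obtain ⟨N, κ, _, _, B, hN, hB, -⟩ := B₀.exists_isMinimal hpos hd
  obtain ⟨i, r, hir⟩ := hN₀.trans hN
  obtain ⟨n, h_mem, h_zero⟩ := CellBasis.exists_iterate_mem_filt (f := Hom.toLin (r ≫ i))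
    fun q hq m hm => hB.map_mem_filt hpos hX.2 r i hq hm
  obtain ⟨ψ, hψ, h_left, h_right⟩ := exists_iterate_homotopic hir n
  have h_incl (x : X.as.carrier) : Hom.toLin (i ≫ ψ) x ∈ B.filt 0 := hψ _ ▸ h_mem _
  have h_proj {m : N.carrier} (hm : m ∈ B.filt 0) :
      Hom.toLin (ψ ≫ r) (B.component 0 m) = Hom.toLin (ψ ≫ r) m := by
    rw [eq_comm, ← sub_eq_zero, ← map_sub, comp_toLin, hψ,
      h_zero _ (CellBasis.sub_component_mem_filt hm), map_zero]
  let p := hB.slice hpos 0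
  let ι : X.as ⟶ p.module := p.factorThru (i ≫ ψ) fun x => hB.component_d_component hpos (h_incl x)
  let ρ : p.module ⟶ X.as := p.restrict (ψ ≫ r) fun m =>
    h_proj (hB.d_mem_filt hpos (B.component_mem_filt 0 m))
  have h_comp : ι ≫ ρ = (i ≫ ψ) ≫ ψ ≫ r := hom_ext fun x => h_proj (h_incl x)
  refine ⟨_, _, _, _, hB.sliceBasis hpos 0, fun l => (Finset.mem_filter.1 l.2).2, ι, ρ, ?_⟩
  rw [h_comp]
  exact (h_left.comp_right _).trans ((h_right.comp_left i).trans hir)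

/-! ### Support and cocycles -/

lemma DGAlgebra.d_one (𝓐 : DGAlgebra k A) : 𝓐.d 1 = 0 := by
  have := 𝓐.d_mul 0 1 SetLike.GradedOne.one_mem 1
  rwa [mul_one, one_mul, mul_one, Int.negOnePow_zero, one_smul, left_eq_add] at this

namespace DGModule

variable {M N : DGModule 𝓐}

lemma regular_gr_eq_bot (hpos : ∀ i : ℤ, i < 0 → 𝓐.gr i = ⊥) {i : ℤ} (hi : i < 0) :
    (regular 𝓐).gr i = ⊥ :=
  congrArg Submodule.toAddSubgroup (hpos i hi)

lemma notMem_barSupport_regular (hpos : ∀ i : ℤ, i < 0 → 𝓐.gr i = ⊥) {i : ℤ} (hi : i ≠ 0) :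
    i ∉ (regular 𝓐).barSupport := by
  refine notMem_barSupport_iff.2 fun a ha _ => ⟨0, zero_mem _, ?_⟩
  rw [map_zero, sub_zero]
  rcases hi.lt_or_gt with h | h
  · rw [regular_gr_eq_bot hpos h, AddSubgroup.mem_bot] at ha
    rw [ha]
    exact zero_mem _
  · have := smul_mem_mulAugmentation h (ofRegular_mem.2 ha) (toRegular 𝓐 1)
    rwa [← map_smul, op_smul_eq_mul, one_mul, toRegular_ofRegular] at this

lemma notMem_barSupport_shift {n i : ℤ} (h : i + n ∉ M.barSupport) :
    i ∉ (M.shift n).barSupport := by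
  rw [notMem_barSupport_iff] at h ⊢
  intro m hm hdm
  obtain ⟨m', hm', h_sub⟩ := h (M.ofShift n m) hm <| by
    rw [d_ofShift, Units.smul_def]
    exact zsmul_mem (map_mem_mulAugmentation (M.ofShift n) hdm) _
  refine ⟨n.negOnePow • M.toShift n m', ?_, ?_⟩
  · rw [Units.smul_def]
    refine zsmul_mem ?_ _
    rwa [toShift_mem, sub_add_eq_add_sub]
  · have := map_mem_mulAugmentation (M.toShift n) h_sub
    rwa [Units.smul_def, map_zsmul, d_toShift, Units.smul_def, smul_smul, ← Units.val_mul,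
      Int.units_mul_self, Units.val_one, one_smul, ← toShift_ofShift M n m, ← map_sub]

lemma notMem_barSupport_cone (f : M ⟶ N) {i : ℤ} (hN : i ∉ N.barSupport)
    (hM : i + 1 ∉ M.barSupport) : i ∉ (cone f).barSupport := by
  rw [notMem_barSupport_iff] at hN hM ⊢
  intro x hx hdx
  obtain ⟨hx_fst, hx_snd⟩ := (mem_cone_gr f).1 hx
  have hdx_fst := map_mem_mulAugmentation (coneFst f) hdx
  have hdx_snd := map_mem_mulAugmentation (coneSnd f) hdx
  rw [coneSnd_d, neg_mem_iff] at hdx_snd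
  obtain ⟨m, hm, hm'⟩ := hM _ hx_snd hdx_snd
  rw [add_sub_cancel_right] at hm
  obtain ⟨n, hn, hn'⟩ := hN _ (add_mem hx_fst (Hom.map_mem f _ _ hm)) <| by
    have := sub_mem hdx_fst (map_mem_mulAugmentation (Hom.toLin f) hm')
    rwa [coneFst_d, map_sub, add_sub_assoc, sub_sub_cancel, Hom.map_d f, ← map_add] at this
  refine ⟨coneInl f n - coneInr f m, sub_mem (coneInl_mem f hn) (coneInr_mem f hm), ?_⟩
  have h_eq : x - (cone f).d (coneInl f n - coneInr f m) =
      coneInl f (coneFst f x + Hom.toLin f m - N.d n) + coneInr f (coneSnd f x - M.d m) := by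
    refine cone_ext ?_ (by simp)
    simp only [map_sub, map_add, coneFst_d, coneFst_coneInl, coneFst_coneInr, coneSnd_coneInl,
      coneSnd_coneInr, map_zero]
    abel
  rw [h_eq]
  exact add_mem (map_mem_mulAugmentation _ hn') (map_mem_mulAugmentation _ hm')

section Cocycle

variable {n : ℤ} {z : M.carrier}

/-- The linear map `{-n}𝓐 → M` that sends `1` to `z`. -/
def orbit (n : ℤ) (z : M.carrier) : ((regular 𝓐).shift (-n)).carrier →ₗ[Aᵐᵒᵖ] M.carrier where
  toFun a := op (ofRegular 𝓐 ((regular 𝓐).ofShift (-n) a)) • z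
  map_add' a b := by rw [map_add, map_add, MulOpposite.op_add, add_smul]
  map_smul' r a := by
    obtain ⟨b, rfl⟩ := op_surjective r
    rw [map_smul, map_smul, op_smul_eq_mul, op_mul, mul_smul, RingHom.id_apply]

lemma orbit_apply (a : ((regular 𝓐).shift (-n)).carrier) :
    orbit n z a = op (ofRegular 𝓐 ((regular 𝓐).ofShift (-n) a)) • z := rfl

lemma orbit_mem {j : ℤ} (hz : z ∈ M.gr (n + j)) {i : ℤ} {a : ((regular 𝓐).shift (-n)).carrier}
    (ha : a ∈ ((regular 𝓐).shift (-n)).gr i) : orbit n z a ∈ M.gr (i + j) := by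
  have := M.smul_mem _ _ _ hz _ (ofRegular_mem.2 ((regular 𝓐).ofShift_mem.2 ha))
  rwa [show n + j + (i + -n) = i + j by ring] at this

lemma d_orbit {j : ℤ} (hz : z ∈ M.gr (n + j)) (a : ((regular 𝓐).shift (-n)).carrier) :
    M.d (orbit n z a) =
      orbit n (M.d z) a + j.negOnePow • orbit n z (((regular 𝓐).shift (-n)).d a) := by
  have h_sign : (n + j).negOnePow = j.negOnePow * (-n).negOnePow := by
    rw [Int.negOnePow_add, Int.negOnePow_neg, mul_comm]
  have h_d : ofRegular 𝓐 ((regular 𝓐).ofShift (-n) (((regular 𝓐).shift (-n)).d a)) =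
      (-n).negOnePow • 𝓐.d (ofRegular 𝓐 ((regular 𝓐).ofShift (-n) a)) := rfl
  rw [orbit_apply, M.d_smul _ _ hz, orbit_apply, orbit_apply, h_d, h_sign, mul_smul]
  congr 2
  rcases Int.units_eq_one_or (-n).negOnePow with h | h <;> simp [h]

/-- The morphism `{-n}𝓐 ⟶ M` that represents a cocycle of degree `n`. -/
def ofCocycle (hz : z ∈ M.gr n) (hdz : M.d z = 0) : (regular 𝓐).shift (-n) ⟶ M where
  toLin := orbit n z
  map_mem i a ha := by
    have := orbit_mem (j := 0) (by rwa [add_zero]) ha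
    rwa [add_zero] at this
  map_d a := by
    rw [d_orbit (j := 0) (by rwa [add_zero]), hdz, Int.negOnePow_zero, one_smul]
    simp [orbit_apply]

lemma ofCocycle_comp_homotopic_zero_iff (hz : z ∈ M.gr n) (hdz : M.d z = 0) (f : M ⟶ N) :
    Homotopic (ofCocycle hz hdz ≫ f) 0 ↔ ∃ x ∈ N.gr (n - 1), N.d x = Hom.toLin f z := by
  constructor
  · rintro ⟨h, h_mem, h_eq⟩
    let one := (regular 𝓐).toShift (-n) (toRegular 𝓐 1)
    have h_one : one ∈ ((regular 𝓐).shift (-n)).gr n := by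
      rw [toShift_mem, toRegular_mem, add_neg_cancel]
      exact SetLike.GradedOne.one_mem
    have h_d_one : ((regular 𝓐).shift (-n)).d one = 0 := by
      rw [d_toShift, d_toRegular, 𝓐.d_one, map_zero, map_zero, smul_zero]
    refine ⟨h one, h_mem n one h_one, ?_⟩
    have := h_eq one
    rw [h_d_one, map_zero, add_zero, zero_toLin, sub_zero, comp_toLin] at this
    rw [← this]
    exact congrArg (Hom.toLin f) (one_smul _ z)
  · rintro ⟨x, hx, hdx⟩
    refine ⟨orbit n x, fun i a ha => orbit_mem hx ha, fun a => ?_⟩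
    rw [d_orbit hx, hdx, Int.negOnePow_neg, Int.negOnePow_one, Units.neg_smul, one_smul,
      neg_add_cancel_right, zero_toLin, sub_zero]
    exact map_smul (Hom.toLin f) _ z

end Cocycle

end DGModule

/-! ### Obstruction theory -/

namespace CellBasis

variable {M N V W : DGModule 𝓐} {ι : Type} [LinearOrder ι] [Fintype ι] (B : CellBasis M ι)

lemma gr_eq_bot_of_lt (hpos : ∀ i : ℤ, i < 0 → 𝓐.gr i = ⊥) {i : ℤ} (h : ∀ l, i < B.deg l) :
    M.gr i = ⊥ :=
  (AddSubgroup.eq_bot_iff_forall _).2 fun _ hm => B.ext_coord fun l => by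
    rw [B.coord_eq_zero_of_lt hpos hm (h l), map_zero]

lemma homotopic_zero_of_comp_coneInlHom {f : V ⟶ W} (hV : ∀ l, V.gr (B.deg l) = ⊥) {u : M ⟶ W}
    (hu : Homotopic (u ≫ coneInlHom f) 0) : Homotopic u 0 := by
  obtain ⟨h, h_mem, h_eq⟩ := hu
  have h_snd : coneSnd f ∘ₗ h = 0 := B.linearMap_ext fun l => by
    have := ((mem_cone_gr f).1 (h_mem _ _ (B.v_mem l))).2
    rwa [sub_add_cancel, hV, AddSubgroup.mem_bot] at this
  refine ⟨coneFst f ∘ₗ h, fun i m hm => (h_mem i m hm).1, fun m => ?_⟩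
  have := congrArg (coneFst f) (h_eq m)
  have h_snd_m : coneSnd f (h m) = 0 := LinearMap.congr_fun h_snd m
  rw [zero_toLin, sub_zero, comp_toLin, coneInlHom_toLin, coneFst_coneInl, map_add, coneFst_d,
    h_snd_m, map_zero, add_zero] at this
  rwa [zero_toLin, sub_zero]

lemma exists_homotopic_map_v_eq_zero (hd : ∀ a ∈ 𝓐.gr 0, 𝓐.d a = 0) (ψ : M ⟶ W) {a : ι}
    (h_mat : B.mat a a = 0)
    (hψ : ∃ y ∈ W.gr (B.deg a - 1), W.d y = Hom.toLin ψ (B.v a)) :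
    ∃ ψ' : M ⟶ W, Homotopic ψ ψ' ∧ Hom.toLin ψ' (B.v a) = 0 ∧
      ∀ l ≠ a, B.mat a l = 0 → Hom.toLin ψ' (B.v l) = Hom.toLin ψ (B.v l) := by
  obtain ⟨y, hy, hdy⟩ := hψ
  have h_single {l : ι} (hl : B.mat a l = 0) : B.single a y (M.d (B.v l)) = 0 := by
    rw [single_apply, ← mat, hl, op_zero, zero_smul]
  refine ⟨ψ - nullHom (B.single a y) fun _ _ hm => B.single_mem hy hm,
    homotopic_sub_nullHom _ _ _, ?_, fun l hla hl => ?_⟩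
  · rw [sub_toLin, nullHom_toLin, h_single h_mat, add_zero, single_apply, B.coord_self,
      W.d_smul _ _ hy, hd _ (B.e a).2, op_zero, zero_smul, smul_zero, add_zero, hdy, ← map_smul,
      B.smul_v, sub_self]
  · rw [sub_toLin, nullHom_toLin, h_single hl, B.single_of_ne hla.symm, map_zero, add_zero,
      sub_zero]

namespace IsMinimal

variable {B} (hpos : ∀ i : ℤ, i < 0 → 𝓐.gr i = ⊥) (hB : B.IsMinimal)
include hpos hB

lemma deg_lt_or_lt {l j : ι} (h : B.mat l j ≠ 0) : B.deg l < B.deg j ∨ B.deg l = B.deg j ∧ l < j :=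
  (hB.deg_le hpos h).lt_or_eq.imp_right fun h_eq =>
    ⟨h_eq, lt_of_not_ge fun h_le => h (B.triangular l j h_le (.inl h_eq))⟩

lemma mat_eq_zero_of_deg_lt {l j : ι} (h : B.deg j < B.deg l) : B.mat l j = 0 := by
  by_contra h_ne
  exact (hB.deg_le hpos h_ne).not_gt h

lemma d_map_v_eq_zero {ψ : M ⟶ W} {a : ι}
    (hψ : ∀ l, B.deg l < B.deg a ∨ B.deg l = B.deg a ∧ l < a → Hom.toLin ψ (B.v l) = 0) :
    W.d (Hom.toLin ψ (B.v a)) = 0 := by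
  rw [← Hom.map_d, ← B.sum_coord (M.d (B.v a)), map_sum]
  refine Finset.sum_eq_zero fun l _ => ?_
  rw [map_smul, ← mat]
  rcases eq_or_ne (B.mat l a) 0 with h | h
  · rw [h, op_zero, zero_smul]
  · rw [hψ l (hB.deg_lt_or_lt hpos h), smul_zero]

lemma exists_homotopic_eq_zero_of_le (hd : ∀ a ∈ 𝓐.gr 0, 𝓐.d a = 0) {ψ : M ⟶ W} {a : ι}
    (hψ : ∀ l, B.deg l < B.deg a ∨ B.deg l = B.deg a ∧ l < a → Hom.toLin ψ (B.v l) = 0)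
    (h_obs : W.d (Hom.toLin ψ (B.v a)) = 0 →
      ∃ y ∈ W.gr (B.deg a - 1), W.d y = Hom.toLin ψ (B.v a)) :
    ∃ ψ', Homotopic ψ ψ' ∧
      ∀ l, B.deg l < B.deg a ∨ B.deg l = B.deg a ∧ l ≤ a → Hom.toLin ψ' (B.v l) = 0 := by
  obtain ⟨ψ', h, h_zero, h_eq⟩ := B.exists_homotopic_map_v_eq_zero hd ψ
    (B.triangular a a le_rfl (.inl rfl)) (h_obs (hB.d_map_v_eq_zero hpos hψ))
  refine ⟨ψ', h, fun l hl => ?_⟩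
  by_cases hla : l = a
  · rwa [hla]
  rcases hl with hl | ⟨hl, hle⟩
  · rw [h_eq l hla (hB.mat_eq_zero_of_deg_lt hpos hl), hψ l (.inl hl)]
  · rw [h_eq l hla (B.triangular a l hle (.inl hl.symm)), hψ l (.inr ⟨hl, hle.lt_of_ne hla⟩)]

lemma exists_homotopic_eq_zero_of_obstruction (hd : ∀ a ∈ 𝓐.gr 0, 𝓐.d a = 0) {ψ : M ⟶ W} {q : ℤ}
    (hψ : ∀ l, B.deg l < q → Hom.toLin ψ (B.v l) = 0)
    (h_obs : ∀ ψ', Homotopic ψ ψ' → ∀ l, B.deg l = q → W.d (Hom.toLin ψ' (B.v l)) = 0 →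
      ∃ y ∈ W.gr (q - 1), W.d y = Hom.toLin ψ' (B.v l)) :
    ∃ ψ', Homotopic ψ ψ' ∧ ∀ l, B.deg l ≤ q → Hom.toLin ψ' (B.v l) = 0 := by
  suffices ∀ s : Finset ι, IsLowerSet (s : Set ι) → ∃ ψ', Homotopic ψ ψ' ∧
      ∀ l, B.deg l < q ∨ B.deg l = q ∧ l ∈ s → Hom.toLin ψ' (B.v l) = 0 by
    obtain ⟨ψ', h, h_zero⟩ := this Finset.univ (by rw [Finset.coe_univ]; exact isLowerSet_univ)
    exact ⟨ψ', h, fun l hl => h_zero l (hl.lt_or_eq.imp_right fun h => ⟨h, Finset.mem_univ l⟩)⟩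
  intro s
  induction s using Finset.induction_on_max with
  | empty => exact fun _ => ⟨ψ, .refl ψ, fun l hl => hψ l (by simpa using hl)⟩
  | insert a s has ih =>
    intro h_lower
    have mem_of_lt {l : ι} (hla : l < a) : l ∈ s :=
      Finset.mem_of_mem_insert_of_ne (h_lower hla.le (Finset.mem_insert_self a s)) hla.ne
    obtain ⟨ψ₁, h₁, h₁_zero⟩ := ih fun j l hlj hj => mem_of_lt (hlj.trans_lt (has j hj))
    by_cases ha : B.deg a = q
    · subst ha
      obtain ⟨ψ₂, h₂, h₂_zero⟩ := hB.exists_homotopic_eq_zero_of_le hpos hd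
        (fun l hl => h₁_zero l (hl.imp_right (And.imp_right mem_of_lt))) (h_obs ψ₁ h₁ a rfl)
      refine ⟨ψ₂, h₁.trans h₂, fun l hl => h₂_zero l (hl.imp_right (And.imp_right fun h => ?_))⟩
      exact (Finset.mem_insert.1 h).elim le_of_eq fun h => (has l h).le
    · refine ⟨ψ₁, h₁, fun l hl => h₁_zero l (hl.imp_right fun h => ⟨h.1, ?_⟩)⟩
      exact Finset.mem_of_mem_insert_of_ne h.2 (by rintro rfl; exact ha h.1)

lemma map_v_eq_zero_of_homotopic_zero {q : ℤ} (hq : ∀ l, q ≤ B.deg l) (hW : W.gr (q - 1) = ⊥)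
    {ψ : M ⟶ W} (hψ : Homotopic ψ 0) {l : ι} (hl : B.deg l = q) : Hom.toLin ψ (B.v l) = 0 := by
  obtain ⟨h, h_mem, h_eq⟩ := hψ
  have h_filt {m : M.carrier} (hm : m ∈ B.filt q) : h m = 0 :=
    map_eq_zero_of_mem_filt (fun j hj => by
      have := h_mem _ _ (B.v_mem j)
      rwa [hj.antisymm (hq j), hW, AddSubgroup.mem_bot] at this) hm
  have hv : B.v l ∈ B.filt q := B.v_mem_filt hl.le
  have := h_eq (B.v l)
  rwa [zero_toLin, sub_zero, h_filt hv, h_filt (hB.d_mem_filt hpos hv), map_zero, add_zero] at this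

lemma exists_homotopic_eq_zero_of_comp (hd : ∀ a ∈ 𝓐.gr 0, 𝓐.d a = 0) {q : ℤ}
    (hq : ∀ l, q ≤ B.deg l) (hW : W.gr (q - 1) = ⊥) {φ : V ⟶ W}
    (hφ : ∀ z ∈ V.gr q, V.d z = 0 → Hom.toLin φ z = 0 → ∃ y ∈ V.gr (q - 1), V.d y = z)
    {ψ : M ⟶ V} (hψ : Homotopic (ψ ≫ φ) 0) :
    ∃ ψ', Homotopic ψ ψ' ∧ ∀ l, B.deg l ≤ q → Hom.toLin ψ' (B.v l) = 0 :=
  hB.exists_homotopic_eq_zero_of_obstruction hpos hd (fun l hl => absurd (hq l) hl.not_ge)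
    fun ψ' h l hl h_cocycle => hφ _ (hl ▸ Hom.map_mem ψ' _ _ (B.v_mem l)) h_cocycle
      (hB.map_v_eq_zero_of_homotopic_zero hpos hq hW ((h.symm.comp_right φ).trans hψ) hl)

lemma homotopic_zero_of_cohomology (hd : ∀ a ∈ 𝓐.gr 0, 𝓐.d a = 0) {q : ℤ} (hq : ∀ l, B.deg l ≤ q)
    (hW : ∀ z ∈ W.gr q, W.d z = 0 → ∃ y ∈ W.gr (q - 1), W.d y = z) {ψ : M ⟶ W}
    (hψ : ∀ l, B.deg l < q → Hom.toLin ψ (B.v l) = 0) : Homotopic ψ 0 := by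
  obtain ⟨ψ', h, h_zero⟩ := hB.exists_homotopic_eq_zero_of_obstruction hpos hd hψ
    fun ψ' _ l hl h_cocycle => hW _ (hl ▸ Hom.map_mem ψ' _ _ (B.v_mem l)) h_cocycle
  have h_eq : Hom.toLin ψ' = Hom.toLin (0 : M ⟶ W) := B.linearMap_ext fun l => by
    rw [h_zero l (hq l), zero_toLin]
  rwa [hom_ext (LinearMap.congr_fun h_eq)] at h

end IsMinimal

end CellBasis

/-! ### Injective objects of the heart -/

lemma CellBasis.exists_isMinimal_cone {M N : DGModule 𝓐} {ι κ : Type} [LinearOrder ι] [Fintype ι]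
    [LinearOrder κ] [Fintype κ] (hpos : ∀ i : ℤ, i < 0 → 𝓐.gr i = ⊥)
    (hd : ∀ a ∈ 𝓐.gr 0, 𝓐.d a = 0) {B : CellBasis M ι} {C : CellBasis N κ}
    (hB : ∀ l, B.deg l = 0) (hC : ∀ l, C.deg l = 0) (f : M ⟶ N) :
    ∃ (Z : DGModule 𝓐) (μ : Type) (_ : LinearOrder μ) (_ : Fintype μ) (D : CellBasis Z μ),
      IsHomotopyRetract (DGModule.cone f) Z ∧ D.IsMinimal ∧ ∀ l, D.deg l = -1 ∨ D.deg l = 0 := by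
  obtain ⟨Z, μ, _, _, D, hZ, hD, h_range⟩ := (B.cone C f).exists_isMinimal hpos hd
  refine ⟨Z, μ, _, _, D, hZ, hD, fun l => ?_⟩
  obtain ⟨j, hj⟩ := h_range ⟨l, rfl⟩
  rw [← hj]
  cases j using Lex.rec with | _ j
  rcases j with j | j
  · exact .inr (hC j)
  · exact .inl (by simp [CellBasis.cone, hB])

/-- On a minimal model of `cone (r ≫ φ)`, whose generators have degrees `-1` and `0`, the
connecting morphism to `{1}X` can be deformed to zero on the generators of degree `-1` because
`H⁰(φ)` is injective; its composition with `{1}g` can then be deformed to zero on the remaining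
generators because `H¹(M) = 0`. -/
lemma homotopic_coneSndHom_comp_zero (hpos : ∀ i : ℤ, i < 0 → 𝓐.gr i = ⊥)
    (hd : ∀ a ∈ 𝓐.gr 0, 𝓐.d a = 0) {X' Y' X M : DGModule 𝓐} {ι κ : Type} [LinearOrder ι]
    [Fintype ι] [LinearOrder κ] [Fintype κ] {B : CellBasis X' ι} {C : CellBasis Y' κ}
    (hB : ∀ l, B.deg l = 0) (hC : ∀ l, C.deg l = 0) (r : X' ⟶ X) {φ : X ⟶ Y'}
    (hφ : ∀ z ∈ X.gr 0, X.d z = 0 → Hom.toLin φ z = 0 → ∃ y ∈ X.gr (0 - 1), X.d y = z)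
    (hM : ∀ z ∈ M.gr 1, M.d z = 0 → ∃ y ∈ M.gr (1 - 1), M.d y = z) (g : X ⟶ M) :
    Homotopic (coneSndHom (r ≫ φ) ≫ shiftMap (r ≫ g) 1) 0 := by
  obtain ⟨Z, μ, _, _, D, ⟨β, α, hβα⟩, hD, h_deg⟩ :=
    CellBasis.exists_isMinimal_cone hpos hd hB hC (r ≫ φ)
  have d_ofShift_eq_zero {V : DGModule 𝓐} {z : (V.shift 1).carrier} (hz : (V.shift 1).d z = 0) :
      V.d (V.ofShift 1 z) = 0 := by rw [d_ofShift, hz, map_zero, smul_zero]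
  let θ : Z ⟶ X.shift 1 := α ≫ coneSndHom (r ≫ φ) ≫ shiftMap r 1
  have hθφ : Homotopic (θ ≫ shiftMap φ 1) 0 := (homotopic_coneSndHom_comp (r ≫ φ)).zero_comp α
  have hY' : (Y'.shift 1).gr (-1 - 1) = ⊥ := C.gr_eq_bot_of_lt hpos fun l => by rw [hC]; norm_num
  obtain ⟨θ', hθ', hθ'_zero⟩ := hD.exists_homotopic_eq_zero_of_comp hpos hd
    (fun l => by have := h_deg l; omega) hY'
    (fun z hz hdz hφz => exists_shift_d_eq (hφ _ hz (d_ofShift_eq_zero hdz) hφz)) hθφ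
  have hθ'g : Homotopic (θ' ≫ shiftMap g 1) 0 := hD.homotopic_zero_of_cohomology hpos hd (q := 0)
    (fun l => by have := h_deg l; omega)
    (fun z hz hdz => exists_shift_d_eq (hM _ hz (d_ofShift_eq_zero hdz)))
    fun l hl => by rw [comp_toLin, hθ'_zero l (by have := h_deg l; omega), map_zero]
  exact .zero_of_retract hβα ((hθ'.comp_right (shiftMap g 1)).trans hθ'g)

lemma exists_comp_homotopic (hpos : ∀ i : ℤ, i < 0 → 𝓐.gr i = ⊥)
    (hss : IsSemisimpleRing ↥(𝓐.gr 0)) (hd : ∀ a ∈ 𝓐.gr 0, 𝓐.d a = 0) {X Y : DGHot 𝓐}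
    (hX : perfectSupportedIn 𝓐 {0} X) (hY : perfectSupportedIn 𝓐 {0} Y) {f : X.as ⟶ Y.as}
    (hf : ∀ z ∈ X.as.gr 0, X.as.d z = 0 → (∃ y ∈ Y.as.gr (0 - 1), Y.as.d y = Hom.toLin f z) →
      ∃ y ∈ X.as.gr (0 - 1), X.as.d y = z)
    {M : DGModule 𝓐} (hM : ∀ z ∈ M.gr 1, M.d z = 0 → ∃ y ∈ M.gr (1 - 1), M.d y = z)
    (g : X.as ⟶ M) : ∃ h : Y.as ⟶ M, Homotopic (f ≫ h) g := by
  obtain ⟨X', ι, _, _, B, hB, iX, rX, h_iX⟩ := exists_cellBasis_deg_zero hpos hss hd hX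
  obtain ⟨Y', κ, _, _, C, hC, iY, rY, h_iY⟩ := exists_cellBasis_deg_zero hpos hss hd hY
  have h_inj (z : X.as.carrier) (hz : z ∈ X.as.gr 0) (hdz : X.as.d z = 0)
      (hfz : Hom.toLin (f ≫ iY) z = 0) : ∃ y ∈ X.as.gr (0 - 1), X.as.d y = z :=
    hf z hz hdz <| exists_d_eq_of_map_eq_zero h_iY (Hom.map_mem f _ _ hz)
      (by rw [← Hom.map_d, hdz, map_zero]) hfz
  obtain ⟨h, hh⟩ := exists_comp_homotopic_of_coneSndHom_comp
    (homotopic_coneSndHom_comp_zero hpos hd hB hC rX h_inj hM g)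
  refine ⟨iY ≫ h, homotopic_iff_sub_homotopic_zero.2 (.zero_of_retract h_iX ?_)⟩
  rw [Preadditive.comp_sub, ← homotopic_iff_sub_homotopic_zero]
  simpa only [Category.assoc] using hh

section Heart

/-- The object of the heart given by a dg module. -/
abbrev mkHeart (M : DGModule 𝓐) (h : perfectSupportedIn 𝓐 {0} (toHot M)) : Heart 𝓐 := ⟨toHot M, h⟩

/-- The morphism of the heart given by a morphism of dg modules. -/
abbrev heartMap {X Y : Heart 𝓐} (f : X.obj.as ⟶ Y.obj.as) : X ⟶ Y :=
  ObjectProperty.homMk ((Quotient.functor Homotopic).map f)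

lemma heartMap_surjective {X Y : Heart 𝓐} (f : X ⟶ Y) : ∃ f₀, heartMap f₀ = f := by
  obtain ⟨f₀, hf₀⟩ := (Quotient.functor (Homotopic (𝓐 := 𝓐))).map_surjective
    (X := X.obj.as) (Y := Y.obj.as) f.hom
  exact ⟨f₀, ObjectProperty.hom_ext _ hf₀⟩

lemma heartMap_eq_iff {X Y : Heart 𝓐} {f g : X.obj.as ⟶ Y.obj.as} :
    heartMap f = heartMap g ↔ Homotopic f g := by
  rw [← Quotient.functor_map_eq_iff Homotopic]
  exact ⟨fun h => congrArg (fun x => x.hom) h, fun h => ObjectProperty.hom_ext _ h⟩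

lemma heartMap_comp {X Y Z : Heart 𝓐} (f : X.obj.as ⟶ Y.obj.as) (g : Y.obj.as ⟶ Z.obj.as) :
    heartMap (X := X) (Y := Z) (f ≫ g) = heartMap f ≫ heartMap g :=
  ObjectProperty.hom_ext _ ((Quotient.functor Homotopic).map_comp f g)

lemma mono_heartMap_iff {X Y : Heart 𝓐} {f : X.obj.as ⟶ Y.obj.as} : Mono (heartMap f) ↔
    ∀ (Z : Heart 𝓐) (u : Z.obj.as ⟶ X.obj.as), Homotopic (u ≫ f) 0 → Homotopic u 0 := by
  constructor
  · intro _ Z u hu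
    rw [← heartMap_eq_iff, ← cancel_mono (heartMap f), ← heartMap_comp, ← heartMap_comp,
      heartMap_eq_iff, Limits.zero_comp]
    exact hu
  · refine fun hf => ⟨fun {Z} u v huv => ?_⟩
    obtain ⟨u, rfl⟩ := heartMap_surjective u
    obtain ⟨v, rfl⟩ := heartMap_surjective v
    rw [← heartMap_comp, ← heartMap_comp, heartMap_eq_iff, homotopic_iff_sub_homotopic_zero,
      ← Preadditive.sub_comp] at huv
    rw [heartMap_eq_iff, homotopic_iff_sub_homotopic_zero]
    exact hf Z _ huv

lemma injective_iff_exists_comp_homotopic {M : Heart 𝓐} : Injective M ↔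
    ∀ {X Y : Heart 𝓐} (f : X.obj.as ⟶ Y.obj.as), Mono (heartMap f) →
      ∀ g : X.obj.as ⟶ M.obj.as, ∃ h : Y.obj.as ⟶ M.obj.as, Homotopic (f ≫ h) g := by
  constructor
  · intro _ X Y f _ g
    obtain ⟨h, hh⟩ := heartMap_surjective (Injective.factorThru (heartMap g) (heartMap f))
    refine ⟨h, heartMap_eq_iff.1 ?_⟩
    rw [heartMap_comp, hh, Injective.comp_factorThru]
  · refine fun hM => ⟨fun {X Y} g f _ => ?_⟩
    obtain ⟨g, rfl⟩ := heartMap_surjective g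
    obtain ⟨f, rfl⟩ := heartMap_surjective f
    obtain ⟨h, hh⟩ := hM f ‹_› g
    exact ⟨heartMap h, by rw [← heartMap_comp, heartMap_eq_iff.2 hh]⟩

variable (hpos : ∀ i : ℤ, i < 0 → 𝓐.gr i = ⊥)
include hpos

lemma exists_d_eq_of_mono {X Y : Heart 𝓐} {f : X.obj.as ⟶ Y.obj.as} (hf : Mono (heartMap f))
    {z : X.obj.as.carrier} (hz : z ∈ X.obj.as.gr 0) (hdz : X.obj.as.d z = 0)
    (hfz : ∃ y ∈ Y.obj.as.gr (0 - 1), Y.obj.as.d y = Hom.toLin f z) :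
    ∃ y ∈ X.obj.as.gr (0 - 1), X.obj.as.d y = z := by
  let R : Heart 𝓐 := mkHeart ((regular 𝓐).shift (-0)) ⟨.shift _ _ .regular, fun i hi => by
    by_contra hi₀
    exact notMem_barSupport_shift (notMem_barSupport_regular hpos (by simpa using hi₀)) hi⟩
  have h_zero : Homotopic (ofCocycle hz hdz) 0 :=
    mono_heartMap_iff.1 hf R _ ((ofCocycle_comp_homotopic_zero_iff hz hdz f).2 hfz)
  rw [← Category.comp_id (ofCocycle hz hdz)] at h_zero
  exact (ofCocycle_comp_homotopic_zero_iff hz hdz _).1 h_zero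

lemma perfectSupportedIn_cone_ofCocycle (M : Heart 𝓐) {z : M.obj.as.carrier}
    (hz : z ∈ M.obj.as.gr 1) (hdz : M.obj.as.d z = 0) :
    perfectSupportedIn 𝓐 {0} (toHot (cone (ofCocycle hz hdz))) := by
  refine ⟨.cone _ (.shift _ _ .regular) M.property.1, fun i hi => ?_⟩
  by_contra hi₀
  refine notMem_barSupport_cone _ (fun h => hi₀ (M.property.2 h)) (notMem_barSupport_shift ?_) hi
  rw [add_neg_cancel_right]
  exact notMem_barSupport_regular hpos hi₀

variable (hss : IsSemisimpleRing ↥(𝓐.gr 0)) (hd : ∀ a ∈ 𝓐.gr 0, 𝓐.d a = 0)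
include hss hd

lemma mono_coneInlHom_ofCocycle (M : Heart 𝓐) {z : M.obj.as.carrier} (hz : z ∈ M.obj.as.gr 1)
    (hdz : M.obj.as.d z = 0) :
    Mono (heartMap (X := M) (Y := mkHeart _ (perfectSupportedIn_cone_ofCocycle hpos M hz hdz))
      (coneInlHom (ofCocycle hz hdz))) := by
  refine mono_heartMap_iff.2 fun Z u hu => ?_
  obtain ⟨N, κ, _, _, C, hC, i, r, hir⟩ := exists_cellBasis_deg_zero hpos hss hd Z.property
  refine .zero_of_retract hir (C.homotopic_zero_of_comp_coneInlHom (fun l => ?_) (hu.zero_comp r))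
  exact regular_gr_eq_bot hpos (by rw [hC]; norm_num)

/-- If `M` is injective, then the extension of `{-1}𝓐` by `M` with class `z` splits. -/
lemma subsingleton_cohomology_of_injective (M : Heart 𝓐) [Injective M] :
    Subsingleton (M.obj.as.cohomology 1) := by
  rw [subsingleton_gradedCohomology_iff]
  intro z hz hdz
  obtain ⟨ρ, hρ⟩ := injective_iff_exists_comp_homotopic.1 ‹_› _
    (mono_coneInlHom_ofCocycle hpos hss hd M hz hdz) (𝟙 M.obj.as)
  have h_zero : Homotopic (ofCocycle hz hdz ≫ coneInlHom _ ≫ ρ) 0 := by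
    simpa only [Category.assoc] using (homotopic_comp_coneInlHom (ofCocycle hz hdz)).comp_zero ρ
  exact (ofCocycle_comp_homotopic_zero_iff hz hdz _).1 ((hρ.symm.comp_left _).trans h_zero)

lemma injective_of_subsingleton_cohomology (M : Heart 𝓐)
    (hM : Subsingleton (M.obj.as.cohomology 1)) : Injective M := by
  rw [subsingleton_gradedCohomology_iff] at hM
  exact injective_iff_exists_comp_homotopic.2 fun {X Y} _ hf =>
    exists_comp_homotopic hpos hss hd X.property Y.property
      (fun _ hz hdz => exists_d_eq_of_mono hpos hf hz hdz) hM

end Heart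

end PerfectDG

theorem proposition6p6 {k : Type w} [CommRing k] {A : Type u} [Ring A] [Algebra k A]
    (𝓐 : PerfectDG.DGAlgebra k A)
    (hpos : ∀ i : ℤ, i < 0 → 𝓐.gr i = ⊥)
    (hss : IsSemisimpleRing ↥(𝓐.gr 0))
    (hd : ∀ a ∈ 𝓐.gr 0, 𝓐.d a = 0)
    (M : PerfectDG.Heart 𝓐) :
    CategoryTheory.Injective M ↔ Subsingleton (M.obj.as.cohomology 1) :=
  ⟨fun _ => PerfectDG.subsingleton_cohomology_of_injective hpos hss hd M,
    PerfectDG.injective_of_subsingleton_cohomology hpos hss hd M⟩
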